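/- Consider the controlled SDE $d\mathbf x = f(\mathbf x,u)\,dt + g(\mathbf x)\,d\mathbf w$ with state in $\mathbb R^n$, control in a compact set $U\subset\mathbb R^{k}$, $f:\mathbb R^n\times U\to\mathbb R^n$ and $g:\mathbb R^n\to\mathbb R^{n\times m}$ globally Lipschitz, under a Lipschitz controller $\pi:\mathbb R^n\to U$, with infinitesimal generator $$\mathcal G[W](x)=\sum_i f_i(x,\pi(x))\,\partial_iW(x)+\tfrac12\sum_{i,j}[g(x)g(x)^\top]_{ij}\,\partial_i\partial_jW(x).$$ Let $X\subset\mathbb R^n$ be compact, $X_{\rm s}\subset\operatorname{int}X$ compact, $X_0,X_{\rm g}\subseteq\operatorname{int}X_{\rm s}$ compact, and $X_{\rm u}=X\setminus\operatorname{int}X_{\rm s}$. Let $V_\theta$ be a scalar neural network whose last layer is linear and all of whose other layers are frozen: $V_\theta(x)=\sum_{j=1}^{p}w_j\varphi_j(x)+b$, where the frozen features $\varphi_j$ are twice continuously differentiable around every point of $X$, and $\theta_L=(w,b)\in\mathbb R^{d_v}$, $d_v=p+1$. Let $\varepsilon_{\rm gen}>0$, $\mathrm{ReLU}(y)=\max\{0,y\}$,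 and $$h(\theta_L,\beta,x)=\mathrm{ReLU}(-V_\theta(x))+\mathbf 1_{X_0}(x)\,\mathrm{ReLU}(V_\theta(x)-1)+\mathbf 1_{X_{\rm u}}(x)\,\mathrm{ReLU}(\beta-V_\theta(x))+\mathbf 1_{X\setminus\operatorname{int}(X_{\rm g}\cup X_{\rm u})}(x)\,\mathrm{ReLU}(\mathcal G[V_\theta](x)+\varepsilon_{\rm gen}).$$ For samples $\hat x^{(1)},\dots,\hat x^{(N)}\in X$ consider the scenario program $$\min_{\theta_L\in\mathbb R^{d_v},\ \beta\in\mathbb R}\ -\beta\quad\text{subject to}\quad h(\theta_L,\beta,\hat x^{(i)})\le 0,\quad i=1,\dots,N. \tag{$*$}$$ (i) For all samples in $X$, $(*)$ is a linear program: its objective is linear and its feasible set is the solution set of finitely many affine inequalities. (ii) Let $P$ be a probability distribution on $X$, $\epsilon>0$, $\delta\in(0,1)$, and let $N\ge 2(\log(1/\delta)+d_v)/\epsilon$ samples be drawn independently from $P$. Let $(\theta^*_{L,N},\beta^*_N)$ be the optimizer of $(*)$; if optimizers are not unique, it is the one selected by a fixed convex tie-break rule, i.e. the unique optimizer at which $(t_1,\dots,t_r)$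 is lexicographically least, for fixed convex functions $t_1,\dots,t_r$ of $(\theta_L,\beta)$ (any $r\ge 0$; $r=0$ is the case of a unique optimizer). Then $$P^N\Big[\ \text{if }(*)\text{ has an optimizer, then } P\big[h(\theta^*_{L,N},\beta^*_N,\mathbf x)>0\big]\le\epsilon\ \Big]\ \ge\ 1-\delta ,\qquad \mathbf x\sim P.$$ -/

import Mathlib

open MeasureTheory

/-- The Euclidean space `ℝⁿ`. -/
abbrev Euc (n : ℕ) : Type := EuclideanSpace ℝ (Fin n)

/-- The coefficients of a controlled SDE `dx = f(x, u) dt + g(x) dw` with state in `ℝⁿ`, control in a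
compact set `U ⊆ ℝᵏ` and an `m`-dimensional Brownian motion; `f` (on `ℝⁿ × U`) and `g` are globally
`L`-Lipschitz (Frobenius norm for `g`). -/
structure ControlSDE (n m k : ℕ) where
  U : Set (Euc k)
  f : Euc n → Euc k → Euc n
  g : Euc n → Matrix (Fin n) (Fin m) ℝ
  L : ℝ
  isCompact_U : IsCompact U
  L_pos : 0 < L
  lipschitz_f : ∀ x y : Euc n, ∀ u ∈ U, ∀ v ∈ U, ‖f x u - f y v‖ ≤ L * (‖x - y‖ + ‖u - v‖)
  lipschitz_g : ∀ x y : Euc n,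
    Real.sqrt (∑ i, ∑ j, (g x i j - g y i j) ^ 2) ≤ L * ‖x - y‖

/-- Admissible controllers: globally `L`-Lipschitz maps from `ℝⁿ` to `U`. -/
structure IsController {n m k : ℕ} (S : ControlSDE n m k) (π : Euc n → Euc k) : Prop where
  mem_U : ∀ x, π x ∈ S.U
  lipschitz : ∀ x y, ‖π x - π y‖ ≤ S.L * ‖x - y‖

/-- The sets of a reach-avoid specification: domain `X`, safe set `Xs`, initial set `X0`, goal set
`Xg`. -/
structure ReachAvoidSets (n : ℕ) where
  X : Set (Euc n)
  Xs : Set (Euc n)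
  X0 : Set (Euc n)
  Xg : Set (Euc n)
  isCompact_X : IsCompact X
  isCompact_Xs : IsCompact Xs
  isCompact_X0 : IsCompact X0
  isCompact_Xg : IsCompact Xg
  Xs_subset : Xs ⊆ interior X
  X0_subset : X0 ⊆ interior Xs
  Xg_subset : Xg ⊆ interior Xs

/-- The unsafe set `X \ int Xs`. -/
def ReachAvoidSets.Xu {n : ℕ} (R : ReachAvoidSets n) : Set (Euc n) := R.X \ interior R.Xs

/-- The set `X \ int (Xg ∪ Xu)` on which the generator condition is imposed. -/
def ReachAvoidSets.Xgen {n : ℕ} (R : ReachAvoidSets n) : Set (Euc n) :=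
  R.X \ interior (R.Xg ∪ R.Xu)

noncomputable section

/-- The partial derivative `∂W/∂xᵢ`. -/
def partialDeriv {n : ℕ} (i : Fin n) (W : Euc n → ℝ) (x : Euc n) : ℝ :=
  fderiv ℝ W x (EuclideanSpace.single i 1)

/-- The infinitesimal generator of the SDE in closed loop with the controller `π`:
`∑ᵢ fᵢ(x, π x) ∂ᵢW(x) + ½ ∑ᵢⱼ (g(x) g(x)ᵀ)ᵢⱼ ∂ᵢ∂ⱼW(x)`. -/
def generator {n m k : ℕ} (S : ControlSDE n m k) (π : Euc n → Euc k) (W : Euc n → ℝ)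
    (x : Euc n) : ℝ :=
  ∑ i, S.f x (π x) i * partialDeriv i W x +
    (1 / 2) * ∑ i, ∑ j,
      (S.g x * (S.g x).transpose) i j * partialDeriv i (partialDeriv j W) x

/-- Parameters `θ_L` of the last layer: `p` weights (the first `p` coordinates) and a bias (the last
coordinate), so that `d_v = p + 1`. -/
abbrev LastLayer (p : ℕ) : Type := Fin (p + 1) → ℝ

/-- The scalar network with linear last layer `θ` whose frozen earlier layers compute the feature
map `φ : ℝⁿ → ℝᵖ`. -/
def network {n p : ℕ} (φ : Euc n → Fin p → ℝ) (θ : LastLayer p) (x : Euc n) : ℝ :=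
  ∑ j : Fin p, θ j.castSucc * φ x j + θ (Fin.last p)

def relu (y : ℝ) : ℝ := max 0 y

/-- The indicator function `𝟙_A`. -/
def ind {n : ℕ} (A : Set (Euc n)) (x : Euc n) : ℝ := A.indicator (fun _ => (1 : ℝ)) x

/-- The constraint function `h(θ_L, β, x)`. -/
def constraintFn {n m k p : ℕ} (S : ControlSDE n m k) (π : Euc n → Euc k) (R : ReachAvoidSets n)
    (φ : Euc n → Fin p → ℝ) (εgen : ℝ) (θ : LastLayer p) (β : ℝ) (x : Euc n) : ℝ :=
  relu (-network φ θ x)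
    + ind R.X0 x * relu (network φ θ x - 1)
    + ind R.Xu x * relu (β - network φ θ x)
    + ind R.Xgen x * relu (generator S π (network φ θ) x + εgen)

/-- The feasible set of the scenario program for the samples `xs`; the decision variable is
`z = (θ_L, β)`. -/
def scenarioFeasible {n m k p N : ℕ} (S : ControlSDE n m k) (π : Euc n → Euc k)
    (R : ReachAvoidSets n) (φ : Euc n → Fin p → ℝ) (εgen : ℝ) (xs : Fin N → Euc n) :
    Set (LastLayer p × ℝ) :=
  {z | ∀ i, constraintFn S π R φ εgen z.1 z.2 (xs i) ≤ 0}

/-- The objective `-β`, to be minimized. -/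
def scenarioObjective {p : ℕ} (z : LastLayer p × ℝ) : ℝ := -z.2

/-- The set of minimizers of `obj` over `F`. -/
def argminSet {E : Type*} (obj : E → ℝ) (F : Set E) : Set E :=
  {z | z ∈ F ∧ ∀ z' ∈ F, obj z ≤ obj z'}

/-- "Minimize `obj` over `F`" is a linear program: `obj` is a linear functional and `F` is the
solution set of finitely many affine inequalities. -/
def IsLinearProgram {E : Type*} [AddCommGroup E] [Module ℝ E] (obj : E → ℝ) (F : Set E) : Prop :=
  (∃ c : E →ₗ[ℝ] ℝ, ∀ z, obj z = c z) ∧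
    ∃ (q : ℕ) (a : Fin q → E →ₗ[ℝ] ℝ) (b : Fin q → ℝ), F = {z | ∀ i, a i z ≤ b i}

/-- `z` is the element of `O` singled out by the tie-break functions `t 0, …, t (r - 1)`: it is the
only element of `O` at which `(t 0, …, t (r - 1))` is lexicographically least. With `r = 0` this
says that `z` is the only element of `O`. -/
def IsTieBreakChoice {E : Type*} {r : ℕ} (t : Fin r → E → ℝ) (O : Set E) (z : E) : Prop :=
  z ∈ O ∧ ∀ z' ∈ O, z' ≠ z → toLex (fun i => t i z) < toLex (fun i => t i z')

end

/-! Each ReLU term of `h` is nonnegative, and both `V_θ` and its generator are affine in `θ`, so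
every sample contributes four affine inequalities in the `k = p + 2 = d_v + 1` variables `(θ, β)`.
This is (i); for (ii) it provides closed convex constraints that survive lowering `β`.

For (ii), Helly's theorem is used twice. An optimum is already the optimum for some `k` or fewer of
the scenarios (`exists_small_basis`). Among `m + 1` scenarios, at most `k` are violated by the
optimum of the others (`card_essential_le`); by exchangeability the expected violation after `m`
scenarios is at most `k / (m + 1)`.

Random subsampling turns this mean into an exponential tail. Keep each of the `N` scenarios with
probability `a`. If the optimum `z` has violation above `ε`, the kept set `J` contains a basis with
probability at least `a ^ k`; then `z` is the optimum for `J` and satisfies the other `N - |J|`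
scenarios. For fixed `J`, independence and Markov bound this event by `(1 - ε) ^ (N - |J|) * k / (ε
(|J| + 1))`. Summing over `J` gives `a ^ k * P(bad) ≤ k (a + (1 - a)(1 - ε)) ^ (N + 1) / ((N + 1) ε
a)`, and `a = (k + 1) / (ε (N + 1))` suffices once `k ≥ 3`. For `k = 2` the network is constant, the
only possible optimizer is `(1, 1)`, and a fixed decision is easy to test.

The tie-break rule speaks only about the full sample, whereas subsamples also need unique optima.
The squared norm is therefore appended as a last key; the resulting lexicographic key is strictly
quasiconvex, which is all the Helly arguments need. -/

/-- The minimizers over `A` of a function with values in an arbitrary order. -/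
def keyMin {E K : Type*} [LE K] (key : E → K) (A : Set E) : Set E :=
  {z | z ∈ A ∧ ∀ z' ∈ A, key z ≤ key z'}

/-- Strict quasiconvexity of a function with values in a linear order. -/
def StrictQuasiconvex {E K : Type*} [AddCommGroup E] [Module ℝ E] [LinearOrder K]
    (key : E → K) : Prop :=
  ∀ ⦃x y : E⦄, x ≠ y → ∀ ⦃a b : ℝ⦄, 0 < a → 0 < b → a + b = 1 →
    key (a • x + b • y) < max (key x) (key y)

/-- The tuple `(f 0 z, …, f (K - 1) z)` with its lexicographic order. -/
def lexKey {E : Type*} {K : ℕ} (f : Fin K → E → ℝ) (z : E) : Lex (Fin K → ℝ) :=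
  toLex fun i => f i z

theorem keyMin_of_subset {E K : Type*} [LE K] {key : E → K} {A B : Set E} (hAB : A ⊆ B) {z : E}
    (hz : z ∈ keyMin key B) (hzA : z ∈ A) : z ∈ keyMin key A :=
  ⟨hzA, fun z' hz' => hz.2 z' (hAB hz')⟩

/-! ### Helly-type bounds on the scenarios that determine an optimum -/

section Convexity

variable {E K : Type*} [AddCommGroup E] [Module ℝ E] [LinearOrder K] {key : E → K}

theorem StrictQuasiconvex.convex_lt (h : StrictQuasiconvex key) (a : K) :
    Convex ℝ {z | key z < a} := by
  refine convex_iff_forall_pos.2 fun x hx y hy s t hs ht hst => ?_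
  rcases eq_or_ne x y with rfl | hne
  · rwa [← add_smul, hst, one_smul]
  · exact (h hne hs ht hst).trans (max_lt hx hy)

theorem StrictQuasiconvex.convex_le (h : StrictQuasiconvex key) (a : K) :
    Convex ℝ {z | key z ≤ a} := by
  refine convex_iff_forall_pos.2 fun x hx y hy s t hs ht hst => ?_
  rcases eq_or_ne x y with rfl | hne
  · rwa [← add_smul, hst, one_smul]
  · exact (h hne hs ht hst).le.trans (max_le hx hy)

theorem StrictQuasiconvex.keyMin_subsingleton (h : StrictQuasiconvex key) {A : Set E}
    (hA : Convex ℝ A) : (keyMin key A).Subsingleton := by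
  intro x hx y hy
  by_contra hne
  have hmem : (1 / 2 : ℝ) • x + (1 / 2 : ℝ) • y ∈ A :=
    hA hx.1 hy.1 (by norm_num) (by norm_num) (by norm_num)
  have hlt := h hne (a := 1 / 2) (b := 1 / 2) (by norm_num) (by norm_num) (by norm_num)
  rcases lt_max_iff.1 hlt with h1 | h1
  · exact absurd (hx.2 _ hmem) (not_le.2 h1)
  · exact absurd (hy.2 _ hmem) (not_le.2 h1)

/-- A minimizer over a finite intersection of convex sets is a minimizer over the intersection of
at most `finrank` of them. -/
theorem exists_small_basis [FiniteDimensional ℝ E] (hkey : StrictQuasiconvex key)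
    {ι : Type*} [Fintype ι] (F : ι → Set E) (hF : ∀ i, Convex ℝ (F i)) {z : E}
    (hz : z ∈ keyMin key (⋂ i, F i)) :
    ∃ I : Finset ι, I.card ≤ Module.finrank ℝ E ∧ z ∈ keyMin key (⋂ i ∈ I, F i) := by
  classical
  -- Helly is applied to the `F i` together with the strict sublevel set of `z` (index `none`).
  -- Without a small basis any `finrank + 1` of these sets would meet, and a common point of all
  -- would beat `z`.
  let G : Option ι → Set E := fun o => o.elim {z' | key z' < key z} F
  by_contra hcon
  push Not at hcon
  have hzF : ∀ i, z ∈ F i := Set.mem_iInter.1 hz.1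
  have hne : (⋂ i ∈ (Finset.univ : Finset (Option ι)), G i).Nonempty := by
    refine Convex.helly_theorem' (𝕜 := ℝ) ?_ ?_
    · rintro (_ | i) -
      · exact hkey.convex_lt _
      · exact hF i
    · intro I _ hI
      by_cases hnone : none ∈ I
      · have hcard : I.eraseNone.card ≤ Module.finrank ℝ E := by
          have := Finset.card_eraseNone_of_mem hnone
          omega
        have hnot := hcon _ hcard
        have hzI : z ∈ ⋂ i ∈ I.eraseNone, F i := Set.mem_iInter₂.2 fun i _ => hzF i
        have : ∃ z' ∈ ⋂ i ∈ I.eraseNone, F i, key z' < key z := by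
          by_contra hno
          push Not at hno
          exact hnot ⟨hzI, hno⟩
        obtain ⟨z', hz', hlt⟩ := this
        refine ⟨z', Set.mem_iInter₂.2 ?_⟩
        rintro (_ | i) hi
        · exact hlt
        · exact Set.mem_iInter₂.1 hz' i (Finset.mem_eraseNone.2 hi)
      · refine ⟨z, Set.mem_iInter₂.2 ?_⟩
        rintro (_ | i) hi
        · exact absurd hi hnone
        · exact hzF i
  obtain ⟨x, hx⟩ := hne
  rw [Set.mem_iInter₂] at hx
  have h1 : key x < key z := hx none (Finset.mem_univ _)
  have h2 : x ∈ ⋂ i, F i := Set.mem_iInter.2 fun i => hx (some i) (Finset.mem_univ _)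
  exact absurd (hz.2 x h2) (not_le.2 h1)

/-- Among finitely many convex sets with nonempty intersection, at most `finrank` have the property
that the minimizer over the intersection of the others violates them. -/
theorem card_essential_le_of_nonempty [FiniteDimensional ℝ E] (hkey : StrictQuasiconvex key)
    {ι : Type*} [Fintype ι] (F : ι → Set E) (hF : ∀ i, Convex ℝ (F i))
    (hne : (⋂ i, F i).Nonempty) (Q : Finset ι)
    (hQ : ∀ j ∈ Q, ∃ z ∈ keyMin key (⋂ i ∈ ({j}ᶜ : Set ι), F i), z ∉ F j) :
    Q.card ≤ Module.finrank ℝ E := by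
  classical
  by_contra hcard
  push Not at hcard
  choose! z hz hzF using hQ
  have hQne : Q.Nonempty := Finset.card_pos.1 (by omega)
  -- The sublevel set of the worst leave-one-out optimum contains every `z j`, so Helly yields a
  -- point of all `F i` with key at most `key (z j₀)`. By uniqueness it equals `z j₀`, which is not
  -- in `F j₀`.
  obtain ⟨j₀, hj₀, hmax⟩ := Q.exists_max_image (fun j => key (z j)) hQne
  have hzmem : ∀ j ∈ Q, ∀ i, i ≠ j → z j ∈ F i := fun j hj i hij =>
    Set.mem_iInter₂.1 (hz j hj).1 i hij
  obtain ⟨w, hw⟩ := hne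
  let G : Option ι → Set E := fun o => o.elim {z' | key z' ≤ key (z j₀)} F
  have hG : (⋂ i ∈ (Finset.univ : Finset (Option ι)), G i).Nonempty := by
    refine Convex.helly_theorem' (𝕜 := ℝ) ?_ ?_
    · rintro (_ | i) -
      · exact hkey.convex_le _
      · exact hF i
    · intro I _ hI
      by_cases hnone : none ∈ I
      · have hlt : I.eraseNone.card < Q.card := by
          have := Finset.card_eraseNone_of_mem hnone
          omega
        obtain ⟨j, hj, hjI⟩ := Finset.exists_mem_notMem_of_card_lt_card hlt
        refine ⟨z j, Set.mem_iInter₂.2 ?_⟩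
        rintro (_ | i) hi
        · exact hmax j hj
        · refine hzmem j hj i ?_
          rintro rfl
          exact hjI (Finset.mem_eraseNone.2 hi)
      · refine ⟨w, Set.mem_iInter₂.2 ?_⟩
        rintro (_ | i) hi
        · exact absurd hi hnone
        · exact Set.mem_iInter.1 hw i
  obtain ⟨x, hx⟩ := hG
  rw [Set.mem_iInter₂] at hx
  have hxF : ∀ i, x ∈ F i := fun i => hx (some i) (Finset.mem_univ _)
  have hxle : key x ≤ key (z j₀) := hx none (Finset.mem_univ _)
  have hxA : x ∈ ⋂ i ∈ ({j₀}ᶜ : Set ι), F i := Set.mem_iInter₂.2 fun i _ => hxF i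
  have hxmin : x ∈ keyMin key (⋂ i ∈ ({j₀}ᶜ : Set ι), F i) :=
    ⟨hxA, fun z' hz' => hxle.trans ((hz j₀ hj₀).2 z' hz')⟩
  have hconv : Convex ℝ (⋂ i ∈ ({j₀}ᶜ : Set ι), F i) := convex_iInter₂ fun i _ => hF i
  have := hkey.keyMin_subsingleton hconv hxmin (hz j₀ hj₀)
  exact hzF j₀ hj₀ (this ▸ hxF j₀)

/-- A version of `card_essential_le_of_nonempty` without the nonemptiness, for sets that are closed
under decreasing the last coordinate. -/
theorem card_essential_le {E' : Type*} [AddCommGroup E'] [Module ℝ E'] [FiniteDimensional ℝ E']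
    {key : E' × ℝ → K} (hkey : StrictQuasiconvex key)
    {ι : Type*} [Fintype ι] (F : ι → Set (E' × ℝ)) (hF : ∀ i, Convex ℝ (F i))
    (hdown : ∀ i θ β β', β' ≤ β → (θ, β) ∈ F i → (θ, β') ∈ F i) (Q : Finset ι)
    (hQ : ∀ j ∈ Q, ∃ z ∈ keyMin key (⋂ i ∈ ({j}ᶜ : Set ι), F i), z ∉ F j) :
    Q.card ≤ Module.finrank ℝ (E' × ℝ) := by
  classical
  by_contra hcard
  refine hcard (card_essential_le_of_nonempty hkey F hF ?_ Q hQ)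
  push Not at hcard
  have hfin : Module.finrank ℝ (E' × ℝ) = Module.finrank ℝ E' + 1 := by
    rw [Module.finrank_prod, Module.finrank_self]
  -- Forgetting `β` lowers the dimension by one, so Helly only asks about subfamilies smaller than
  -- `Q`. Each omits some `j ∈ Q`, and `z j` lies in all its sets. Above the common `θ`, a low
  -- enough `β` then serves every `F i`.
  have hne : (⋂ i ∈ (Finset.univ : Finset ι), (LinearMap.fst ℝ E' ℝ) '' F i).Nonempty := by
    refine Convex.helly_theorem' (𝕜 := ℝ) (fun i _ => (hF i).linear_image _) ?_
    intro I _ hI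
    obtain ⟨j, hj, hjI⟩ := Finset.exists_mem_notMem_of_card_lt_card (s := I) (t := Q) (by omega)
    obtain ⟨z, hz, -⟩ := hQ j hj
    refine ⟨z.1, Set.mem_iInter₂.2 fun i hi => ⟨z, Set.mem_iInter₂.1 hz.1 i ?_, rfl⟩⟩
    rintro rfl
    exact hjI hi
  obtain ⟨θ, hθ⟩ := hne
  rw [Set.mem_iInter₂] at hθ
  have hβ : ∀ i, ∃ β, (θ, β) ∈ F i := by
    intro i
    obtain ⟨⟨θ', β⟩, h1, rfl⟩ := hθ i (Finset.mem_univ _)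
    exact ⟨β, h1⟩
  choose β hβ using hβ
  obtain ⟨b, hb⟩ := (Set.finite_range β).bddBelow
  exact ⟨(θ, b), Set.mem_iInter.2 fun i => hdown i θ (β i) b (hb ⟨i, rfl⟩) (hβ i)⟩

end Convexity

/-! ### Lexicographic objectives -/

section LexKey

variable {E : Type*}

theorem lexKey_lt_of_le_of_lt {K : ℕ} {f : Fin K → E → ℝ} {x y : E} (i : Fin K)
    (hle : ∀ j < i, f j x ≤ f j y) (hlt : f i x < f i y) : lexKey f x < lexKey f y := by
  classical
  let s : Finset (Fin K) := Finset.univ.filter fun j => f j x < f j y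
  have hs : s.Nonempty := ⟨i, by simp [s, hlt]⟩
  have hmem : f (s.min' hs) x < f (s.min' hs) y := (Finset.mem_filter.1 (s.min'_mem hs)).2
  have hmi : s.min' hs ≤ i := s.min'_le i (by simp [s, hlt])
  refine ⟨s.min' hs, fun j hj => ?_, hmem⟩
  refine le_antisymm (hle j (hj.trans_le hmi)) (not_lt.1 fun h => ?_)
  exact absurd (s.min'_le j (Finset.mem_filter.2 ⟨Finset.mem_univ _, h⟩)) (not_le.2 hj)

/-- At the first key where `x` and `y` differ, convexity puts any proper convex combination strictly
below the larger value, and earlier keys do not increase. If all keys agree, the strictly convex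
last key decides. -/
theorem strictQuasiconvex_lexKey [AddCommGroup E] [Module ℝ E] {K : ℕ}
    {f : Fin (K + 1) → E → ℝ} (hf : ∀ i, ConvexOn ℝ Set.univ (f i))
    (hlast : StrictConvexOn ℝ Set.univ (f (Fin.last K))) : StrictQuasiconvex (lexKey f) := by
  have main : ∀ ⦃x y : E⦄, x ≠ y → ∀ ⦃a b : ℝ⦄, 0 < a → 0 < b → a + b = 1 →
      lexKey f x ≤ lexKey f y → lexKey f (a • x + b • y) < lexKey f y := by
    intro x y hne a b ha hb hab hle
    rcases hle.eq_or_lt with heq | ⟨i, hi, hlt⟩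
    · have heq' : ∀ i, f i x = f i y := fun i => congrFun (congrArg ofLex heq) i
      refine lexKey_lt_of_le_of_lt (Fin.last K) (fun j _ => ?_) ?_
      · have h := (hf j).2 (Set.mem_univ x) (Set.mem_univ y) ha.le hb.le hab
        rwa [heq' j, ← add_smul, hab, one_smul] at h
      · have h := hlast.2 (Set.mem_univ x) (Set.mem_univ y) hne ha hb hab
        rwa [heq' (Fin.last K), ← add_smul, hab, one_smul] at h
    · refine lexKey_lt_of_le_of_lt i (fun j hj => ?_) ?_
      · have h := (hf j).2 (Set.mem_univ x) (Set.mem_univ y) ha.le hb.le hab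
        have hj' : f j x = f j y := hi j hj
        rwa [hj', ← add_smul, hab, one_smul] at h
      · have h := (hf i).2 (Set.mem_univ x) (Set.mem_univ y) ha.le hb.le hab
        have hlt' : f i x < f i y := hlt
        simp only [smul_eq_mul] at h
        have hax := mul_lt_mul_of_pos_left hlt' ha
        calc f i (a • x + b • y) < a * f i y + b * f i y := by linarith
          _ = f i y := by rw [← add_mul, hab, one_mul]
  intro x y hne a b ha hb hab
  rcases le_total (lexKey f x) (lexKey f y) with h | h
  · rw [max_eq_right h]
    exact main hne ha hb hab h
  · rw [max_eq_left h, add_comm (a • x)]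
    exact main hne.symm hb ha (by rwa [add_comm]) h

theorem lexKey_le_iff {K : ℕ} {f : Fin (K + 1) → E → ℝ} {x y : E} :
    lexKey f x ≤ lexKey f y ↔ f 0 x < f 0 y ∨
      f 0 x = f 0 y ∧ lexKey (fun i => f i.succ) x ≤ lexKey (fun i => f i.succ) y := by
  have hlt : lexKey f x < lexKey f y ↔ f 0 x < f 0 y ∨
      f 0 x = f 0 y ∧ lexKey (fun i => f i.succ) x < lexKey (fun i => f i.succ) y := by
    have h := Fin.pi_lex_lt_cons_cons (α := fun _ : Fin (K + 1) => ℝ) (x₀ := f 0 x) (y₀ := f 0 y)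
      (x := fun i => f i.succ x) (y := fun i => f i.succ y) (fun {_} a b => a < b)
    have hcons : ∀ z, (Fin.cons (f 0 z) fun i => f i.succ z : Fin (K + 1) → ℝ) = fun i => f i z :=
      fun z => Fin.cons_self_tail fun i => f i z
    rw [hcons, hcons] at h
    exact h
  have heq : lexKey f x = lexKey f y ↔
      f 0 x = f 0 y ∧ lexKey (fun i => f i.succ) x = lexKey (fun i => f i.succ) y := by
    simp only [lexKey, toLex_inj, funext_iff]
    exact Fin.forall_fin_succ
  have hle := or_congr hlt heq
  have hle' := le_iff_lt_or_eq (a := lexKey (fun i => f i.succ) x)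
    (b := lexKey (fun i => f i.succ) y)
  refine (le_iff_lt_or_eq (a := lexKey f x) (b := lexKey f y)).trans (hle.trans ?_)
  rw [hle', and_or_left, or_assoc]
  rfl

/-- Lexicographic minimization becomes iterated scalar minimization, which allows the measurability
proof to go by induction on the number of keys. -/
theorem keyMin_lexKey_succ {K : ℕ} (f : Fin (K + 1) → E → ℝ) (A : Set E) :
    keyMin (lexKey f) A = keyMin (lexKey fun i => f i.succ) (argminSet (f 0) A) := by
  ext z
  constructor
  · rintro ⟨hzA, hz⟩
    have h0 : ∀ z' ∈ A, f 0 z ≤ f 0 z' := fun z' hz' => by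
      rcases lexKey_le_iff.1 (hz z' hz') with h | h
      exacts [h.le, h.1.le]
    refine ⟨⟨hzA, h0⟩, fun z' hz' => ?_⟩
    rcases lexKey_le_iff.1 (hz z' hz'.1) with h | h
    · exact absurd (hz'.2 z hzA) (not_le.2 h)
    · exact h.2
  · rintro ⟨⟨hzA, h0⟩, hz⟩
    refine ⟨hzA, fun z' hz' => lexKey_le_iff.2 ?_⟩
    rcases (h0 z' hz').lt_or_eq with h | h
    · exact Or.inl h
    · exact Or.inr ⟨h, hz z' ⟨hz', fun w hw => h ▸ h0 w hw⟩⟩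

/-- The objective, then the tie-break functions, then a final function. -/
def scenarioKeys {r : ℕ} (obj : E → ℝ) (t : Fin r → E → ℝ) (last : E → ℝ) :
    Fin (r + 1 + 1) → E → ℝ :=
  Fin.snoc (α := fun _ => E → ℝ) (Fin.cons (α := fun _ => E → ℝ) obj t) last

/-- The choice beats every other feasible point strictly before the final key is consulted, so
appending any final key does not displace it. -/
theorem keyMin_scenarioKeys_of_isTieBreakChoice {r : ℕ} {obj : E → ℝ} {t : Fin r → E → ℝ}
    {last : E → ℝ} {A : Set E} {z : E} (hz : IsTieBreakChoice t (argminSet obj A) z) :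
    z ∈ keyMin (lexKey (scenarioKeys obj t last)) A := by
  refine ⟨hz.1.1, fun z' hz' => ?_⟩
  have h0 : ∀ w, scenarioKeys obj t last 0 w = obj w := fun w => rfl
  have hs : ∀ (i : Fin r) w, scenarioKeys obj t last i.succ.castSucc w = t i w := by
    intro i w
    simp [scenarioKeys, -Fin.castSucc_succ]
  rcases (hz.1.2 z' hz').lt_or_eq with h | h
  · exact (lexKey_lt_of_le_of_lt 0 (fun j hj => absurd hj (Fin.not_lt_zero j)) h).le
  · rcases eq_or_ne z' z with rfl | hne
    · exact le_rfl
    · obtain ⟨i, hi, hlt⟩ := hz.2 z' ⟨hz', fun w hw => h ▸ hz.1.2 w hw⟩ hne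
      refine (lexKey_lt_of_le_of_lt i.succ.castSucc (fun j hj => ?_) ?_).le
      · obtain ⟨j, rfl⟩ : ∃ j', j = Fin.castSucc j' :=
          ⟨j.castLT (by have := j.is_lt; have := i.is_lt; have : j.val < i.val + 1 := hj; omega), rfl⟩
        refine Fin.cases (fun _ => ?_) (fun j hj => ?_) j hj
        · exact h.le
        · rw [hs, hs]
          exact (hi j (Fin.succ_lt_succ_iff.1 (Fin.castSucc_lt_castSucc_iff.1 hj))).le
      · rw [hs, hs]
        exact hlt

end LexKey

/-! ### Measurability of the optimizer -/

/-- An element of a set, with a default value for the empty set. -/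
noncomputable def selectPoint {E : Type*} [Nonempty E] (A : Set E) : E :=
  open Classical in if h : A.Nonempty then h.some else Classical.arbitrary E

theorem selectPoint_mem {E : Type*} [Nonempty E] {A : Set E} (h : A.Nonempty) : selectPoint A ∈ A := by
  rw [selectPoint, dif_pos h]
  exact h.some_mem

section MeasurableSelection

variable {Ω E : Type*} [MeasurableSpace Ω] [MetricSpace E]

/-- A set-valued map such that the event that it meets a given compact set is measurable. -/
def HitMeasurable (C : Ω → Set E) : Prop :=
  ∀ K : Set E, IsCompact K → MeasurableSet {ω | (C ω ∩ K).Nonempty}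

/-- A continuous function attains its minimum on a compact set, and a countable dense subset detects
whether that minimum is at most `0`. -/
theorem hitMeasurable_sublevel {H : E → Ω → ℝ} (hcont : ∀ ω, Continuous fun z => H z ω)
    (hmeas : ∀ z, Measurable (H z)) : HitMeasurable fun ω => {z | H z ω ≤ 0} := by
  intro K hK
  rcases K.eq_empty_or_nonempty with rfl | hne
  · simp
  have : Nonempty K := hne.to_subtype
  have : CompactSpace K := isCompact_iff_compactSpace.1 hK
  have hset : {ω | ({z | H z ω ≤ 0} ∩ K).Nonempty} =
      ⋂ n : ℕ, ⋃ j : ℕ, {ω | H (TopologicalSpace.denseSeq K j) ω < 1 / ((n : ℝ) + 1)} := by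
    ext ω
    simp only [Set.mem_ofPred_eq, Set.mem_iInter, Set.mem_iUnion]
    constructor
    · rintro ⟨z, hz, hzK⟩ n
      have hopen : IsOpen {y : K | H y ω < 1 / ((n : ℝ) + 1)} :=
        isOpen_lt ((hcont ω).comp continuous_subtype_val) continuous_const
      have hz' : H z ω < 1 / ((n : ℝ) + 1) := lt_of_le_of_lt hz (by positivity)
      exact (TopologicalSpace.denseRange_denseSeq K).exists_mem_open hopen ⟨⟨z, hzK⟩, hz'⟩
    · intro h
      obtain ⟨z, hzK, hmin⟩ := hK.exists_isMinOn hne (hcont ω).continuousOn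
      refine ⟨z, ?_, hzK⟩
      refine (not_lt (a := (0 : ℝ)) (b := H z ω)).1 fun hpos => ?_
      obtain ⟨n, hn⟩ := exists_nat_one_div_lt hpos
      obtain ⟨j, hj⟩ := h n
      have := hmin (TopologicalSpace.denseSeq K j).2
      simp only [Set.mem_ofPred_eq] at this
      linarith
  rw [hset]
  exact MeasurableSet.iInter fun n => MeasurableSet.iUnion fun j =>
    measurableSet_lt (hmeas _) measurable_const

theorem isClosed_argminSet {f : E → ℝ} (hf : Continuous f) {A : Set E} (hA : IsClosed A) :
    IsClosed (argminSet f A) := by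
  have : argminSet f A = A ∩ ⋂ z' ∈ A, {z | f z ≤ f z'} := by
    ext z
    simp [argminSet]
  rw [this]
  exact hA.inter (isClosed_biInter fun z' _ => isClosed_le hf continuous_const)

variable [ProperSpace E]

theorem HitMeasurable.measurableSet_inter_isClosed [Nonempty E] {C : Ω → Set E}
    (hC : HitMeasurable C) {S : Set E} (hS : IsClosed S) :
    MeasurableSet {ω | (C ω ∩ S).Nonempty} := by
  obtain ⟨o⟩ := ‹Nonempty E›
  have hset : {ω | (C ω ∩ S).Nonempty} =
      ⋃ n : ℕ, {ω | (C ω ∩ (Metric.closedBall o n ∩ S)).Nonempty} := by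
    ext ω
    simp only [Set.mem_ofPred_eq, Set.mem_iUnion]
    constructor
    · rintro ⟨z, hz, hzS⟩
      obtain ⟨n, hn⟩ := exists_nat_ge (dist z o)
      exact ⟨n, z, hz, hn, hzS⟩
    · rintro ⟨n, z, hz, -, hzS⟩
      exact ⟨z, hz, hzS⟩
  rw [hset]
  exact MeasurableSet.iUnion fun n => hC _ ((isCompact_closedBall o n).inter_right hS)

/-- A minimizer lies in `K` iff the minimum over `C ω ∩ K` does not exceed the infimum over `C ω`.
Rational thresholds `q` test this: whenever `C ω` goes below `q`, so must `C ω ∩ K`, up to equality.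
The union over `m` writes `f < q` through closed sets. -/
theorem HitMeasurable.argminSet [Nonempty E] {C : Ω → Set E} (hC : HitMeasurable C)
    (hclosed : ∀ ω, IsClosed (C ω)) {f : E → ℝ} (hf : Continuous f) :
    HitMeasurable fun ω => argminSet f (C ω) := by
  intro K hK
  have hset : {ω | (_root_.argminSet f (C ω) ∩ K).Nonempty} =
      {ω | (C ω ∩ K).Nonempty} ∩ ⋂ q : ℚ,
        ((⋃ m : ℕ, {ω | (C ω ∩ {z | f z ≤ q - 1 / ((m : ℝ) + 1)}).Nonempty})ᶜ ∪
          {ω | (C ω ∩ (K ∩ {z | f z ≤ q})).Nonempty}) := by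
    ext ω
    simp only [Set.mem_ofPred_eq, Set.mem_inter_iff, Set.mem_iInter, Set.mem_union,
      Set.mem_compl_iff, Set.mem_iUnion]
    constructor
    · rintro ⟨z, ⟨hzC, hmin⟩, hzK⟩
      refine ⟨⟨z, hzC, hzK⟩, fun q => ?_⟩
      by_cases hq : f z ≤ q
      · exact Or.inr ⟨z, hzC, hzK, hq⟩
      · refine Or.inl ?_
        rintro ⟨m, w, hwC, hw⟩
        have h1 := hmin w hwC
        have h2 : (0 : ℝ) < 1 / ((m : ℝ) + 1) := by positivity
        simp only [Set.mem_ofPred_eq] at hw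
        exact hq (by linarith)
    · rintro ⟨hne, hq⟩
      obtain ⟨z, ⟨hzC, hzK⟩, hmin⟩ :=
        (hK.inter_left (hclosed ω)).exists_isMinOn hne hf.continuousOn
      refine ⟨z, ⟨hzC, fun w hw => ?_⟩, hzK⟩
      by_contra hlt
      obtain ⟨q, hq1, hq2⟩ := exists_rat_btwn (not_le.1 hlt)
      rcases hq q with h | ⟨y, hyC, hyK, hy⟩
      · obtain ⟨m, hm⟩ := exists_nat_one_div_lt (sub_pos.2 hq1)
        exact h ⟨m, w, hw, by simp only [Set.mem_ofPred_eq]; linarith⟩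
      · have h1 : f z ≤ f y := hmin ⟨hyC, hyK⟩
        simp only [Set.mem_ofPred_eq] at hy
        linarith
  rw [hset]
  refine (hC K hK).inter (MeasurableSet.iInter fun q => ?_)
  refine (MeasurableSet.iUnion fun m => ?_).compl.union ?_
  · exact hC.measurableSet_inter_isClosed (isClosed_le hf continuous_const)
  · exact hC _ (hK.inter_right (isClosed_le hf continuous_const))

theorem HitMeasurable.keyMin_lexKey [Nonempty E] {K : ℕ} (f : Fin K → E → ℝ)
    (hf : ∀ i, Continuous (f i)) {C : Ω → Set E} (hC : HitMeasurable C)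
    (hclosed : ∀ ω, IsClosed (C ω)) : HitMeasurable fun ω => keyMin (lexKey f) (C ω) := by
  induction K generalizing C with
  | zero =>
    have : ∀ A : Set E, keyMin (lexKey f) A = A := fun A => by
      ext z
      refine ⟨fun h => h.1, fun h => ⟨h, fun z' _ => (congrArg toLex ?_).le⟩⟩
      exact funext fun i => i.elim0
    simpa only [this] using hC
  | succ K ih =>
    simp only [keyMin_lexKey_succ]
    exact ih _ (fun i => hf i.succ) (hC.argminSet hclosed (hf 0))
      fun ω => isClosed_argminSet (hf 0) (hclosed ω)

/-- For a set with at most one point, the selected point lies in `S` exactly when the set meets `S`;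
the empty case contributes a constant. -/
theorem HitMeasurable.measurable_selectPoint [Nonempty E] [MeasurableSpace E] [BorelSpace E]
    {C : Ω → Set E} (hC : HitMeasurable C) (hsub : ∀ ω, (C ω).Subsingleton) :
    Measurable fun ω => selectPoint (C ω) := by
  refine measurable_of_isClosed fun S hS => ?_
  have hne : MeasurableSet {ω | (C ω).Nonempty} := by
    simpa using hC.measurableSet_inter_isClosed isClosed_univ
  have hset : (fun ω => selectPoint (C ω)) ⁻¹' S = {ω | (C ω ∩ S).Nonempty} ∪
      ({ω | (C ω).Nonempty}ᶜ ∩ {_ω | Classical.arbitrary E ∈ S}) := by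
    ext ω
    simp only [Set.mem_preimage, Set.mem_union, Set.mem_ofPred_eq, Set.mem_inter_iff,
      Set.mem_compl_iff]
    by_cases h : (C ω).Nonempty
    · simp only [h, not_true, false_and, or_false]
      constructor
      · exact fun hS => ⟨_, selectPoint_mem h, hS⟩
      · rintro ⟨z, hz, hzS⟩
        rwa [hsub ω (selectPoint_mem h) hz]
    · have : ¬ (C ω ∩ S).Nonempty := fun h' => h (h'.mono Set.inter_subset_left)
      simp [h, this, selectPoint]
  rw [hset]
  exact (hC.measurableSet_inter_isClosed hS).union (hne.compl.inter (MeasurableSet.const _))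

end MeasurableSelection

/-! ### Scenario programs and the leave-one-out bound -/

section Scenario

/-- Constraints `G z ω ≤ 0` on a decision `z = (θ, β)`, indexed by the scenario `ω`, which define
closed convex sets that are closed under decreasing `β`. -/
structure IsScenarioConstraint {Ω E : Type*} [MeasurableSpace Ω] [NormedAddCommGroup E]
    [NormedSpace ℝ E] (G : E × ℝ → Ω → ℝ) : Prop where
  measurable : ∀ z, Measurable (G z)
  continuous : ∀ ω, Continuous fun z => G z ω
  convex : ∀ ω, Convex ℝ {z | G z ω ≤ 0}
  down : ∀ ω θ β β', β' ≤ β → G (θ, β) ω ≤ 0 → G (θ, β') ω ≤ 0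

/-- A lexicographic objective: continuous convex functions, the last one strictly convex. -/
structure IsConvexKey {E : Type*} [NormedAddCommGroup E] [NormedSpace ℝ E] {K : ℕ}
    (f : Fin (K + 1) → E → ℝ) : Prop where
  continuous : ∀ i, Continuous (f i)
  convex : ∀ i, ConvexOn ℝ Set.univ (f i)
  strict : StrictConvexOn ℝ Set.univ (f (Fin.last K))

/-- The decisions that satisfy the constraints of all the scenarios `y i`. -/
def feasibleSet {Ω E ι : Type*} (G : E → Ω → ℝ) (y : ι → Ω) : Set E := ⋂ i, {z | G z (y i) ≤ 0}

/-- The feasible decisions with lexicographically least keys. -/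
def optSet {Ω E ι : Type*} {K : ℕ} (f : Fin K → E → ℝ) (G : E → Ω → ℝ) (y : ι → Ω) : Set E :=
  keyMin (lexKey f) (feasibleSet G y)

/-- The feasible decision with lexicographically least keys. -/
noncomputable def optPoint {Ω E ι : Type*} [Nonempty E] {K : ℕ} (f : Fin K → E → ℝ)
    (G : E → Ω → ℝ) (y : ι → Ω) : E := selectPoint (optSet f G y)

/-- The probability that the decision `z` violates the constraint of a random scenario. -/
noncomputable def violation {Ω E : Type*} [MeasurableSpace Ω] (P : Measure Ω) (G : E → Ω → ℝ)
    (z : E) : ENNReal := P {ω | 0 < G z ω}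

theorem feasibleSet_comp_surjective {Ω E ι κ : Type*} (G : E → Ω → ℝ) (y : ι → Ω) {e : κ → ι}
    (he : Function.Surjective e) : feasibleSet G (y ∘ e) = feasibleSet G y :=
  he.iInter_comp fun i => {z | G z (y i) ≤ 0}

variable {Ω E : Type*} [MeasurableSpace Ω] [NormedAddCommGroup E] [NormedSpace ℝ E]
  {G : E × ℝ → Ω → ℝ} {K : ℕ} {f : Fin (K + 1) → E × ℝ → ℝ}

theorem optSet_subsingleton (hG : IsScenarioConstraint G) (hf : IsConvexKey f) {ι : Type*}
    (y : ι → Ω) : (optSet f G y).Subsingleton :=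
  (strictQuasiconvex_lexKey hf.convex hf.strict).keyMin_subsingleton
    (convex_iInter fun i => hG.convex (y i))

theorem optPoint_eq (hG : IsScenarioConstraint G) (hf : IsConvexKey f) {ι : Type*} {y : ι → Ω}
    {z : E × ℝ} (hz : z ∈ optSet f G y) : optPoint f G y = z :=
  optSet_subsingleton hG hf y (selectPoint_mem ⟨z, hz⟩) hz

variable [FiniteDimensional ℝ E]

theorem hitMeasurable_optSet (hG : IsScenarioConstraint G) (hf : IsConvexKey f) {ι : Type*}
    [Fintype ι] : HitMeasurable fun y : ι → Ω => optSet f G y := by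
  have : ProperSpace (E × ℝ) := FiniteDimensional.proper ℝ _
  -- Merging all constraints into one continuous function makes the feasible set a single sublevel
  -- set.
  have hset : (fun y : ι → Ω => feasibleSet G y) =
      fun y => {z | ∑ i, max 0 (G z (y i)) ≤ 0} := by
    ext y z
    have hnn : ∀ i ∈ Finset.univ, 0 ≤ max 0 (G z (y i)) := fun i _ => le_max_left _ _
    have h := Finset.sum_eq_zero_iff_of_nonneg hnn
    simp only [feasibleSet, Set.mem_iInter, Set.mem_ofPred_eq]
    rw [(Finset.sum_nonneg hnn).ge_iff_eq', h]
    simp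
  have hhit : HitMeasurable fun y : ι → Ω => feasibleSet G y := by
    rw [hset]
    refine hitMeasurable_sublevel (fun y => ?_) fun z => ?_
    · exact continuous_finsetSum _ fun i _ => continuous_const.max (hG.continuous (y i))
    · exact Finset.measurable_sum _ fun i _ =>
        measurable_const.max ((hG.measurable z).comp (measurable_pi_apply i))
  exact hhit.keyMin_lexKey f hf.continuous fun y =>
    isClosed_iInter fun i => isClosed_le (hG.continuous (y i)) continuous_const

theorem measurableSet_optSet_nonempty (hG : IsScenarioConstraint G) (hf : IsConvexKey f)
    {ι : Type*} [Fintype ι] : MeasurableSet {y : ι → Ω | (optSet f G y).Nonempty} := by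
  have : ProperSpace (E × ℝ) := FiniteDimensional.proper ℝ _
  simpa using (hitMeasurable_optSet hG hf (ι := ι)).measurableSet_inter_isClosed isClosed_univ

variable [MeasurableSpace E] [BorelSpace E]

theorem measurable_optPoint (hG : IsScenarioConstraint G) (hf : IsConvexKey f) {ι : Type*}
    [Fintype ι] : Measurable fun y : ι → Ω => optPoint f G y :=
  have : ProperSpace (E × ℝ) := FiniteDimensional.proper ℝ _
  (hitMeasurable_optSet hG hf).measurable_selectPoint (optSet_subsingleton hG hf)

theorem IsScenarioConstraint.measurable_uncurry (hG : IsScenarioConstraint G) :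
    Measurable (Function.uncurry G) :=
  measurable_uncurry_of_continuous_of_measurable hG.continuous hG.measurable

variable (P : Measure Ω) [IsProbabilityMeasure P]

theorem measurable_violation (hG : IsScenarioConstraint G) : Measurable (violation P G) :=
  measurable_measure_prodMk_left (s := {q : (E × ℝ) × Ω | 0 < G q.1 q.2})
    (measurableSet_lt measurable_const hG.measurable_uncurry)

/-- Leave-one-out bound on the expected violation probability of the optimal decision. -/
theorem lintegral_violation_optPoint_fin_le (hG : IsScenarioConstraint G) (hf : IsConvexKey f)
    (m : ℕ) :
    ((m : ENNReal) + 1) * ∫⁻ y in {y : Fin m → Ω | (optSet f G y).Nonempty},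
      violation P G (optPoint f G y) ∂(Measure.pi fun _ => P) ≤ Module.finrank ℝ (E × ℝ) := by
  classical
  -- A fresh scenario paired with `m` others whose optimum it violates. Any coordinate of `m + 1`
  -- independent scenarios can play the fresh one with the same probability, so `(m + 1)` times this
  -- probability is the expected number of such coordinates.
  let Ess : Set (Ω × (Fin m → Ω)) := {q | (optSet f G q.2).Nonempty ∧ 0 < G (optPoint f G q.2) q.1}
  have hEss : MeasurableSet Ess :=
    (measurable_snd (measurableSet_optSet_nonempty hG hf)).inter
      (measurableSet_lt measurable_const (hG.measurable_uncurry.comp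
        (((measurable_optPoint hG hf).comp measurable_snd).prodMk measurable_fst)))
  have hint : ∫⁻ y in {y : Fin m → Ω | (optSet f G y).Nonempty},
      violation P G (optPoint f G y) ∂(Measure.pi fun _ => P) =
      (P.prod (Measure.pi fun _ : Fin m => P)) Ess := by
    rw [Measure.prod_apply_symm hEss,
      ← lintegral_indicator (measurableSet_optSet_nonempty hG hf)]
    refine lintegral_congr fun y => ?_
    by_cases hy : (optSet f G y).Nonempty
    · rw [Set.indicator_of_mem (by exact hy)]
      simp [violation, Ess, hy]
    · rw [Set.indicator_of_notMem (by exact hy)]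
      simp [Ess, hy]
  let e : (j : Fin (m + 1)) → (Fin (m + 1) → Ω) → Ω × (Fin m → Ω) :=
    fun j => MeasurableEquiv.piFinSuccAbove (fun _ => Ω) j
  have he : ∀ j, MeasurePreserving (e j) (Measure.pi fun _ => P)
      (P.prod (Measure.pi fun _ => P)) :=
    fun j => measurePreserving_piFinSuccAbove (fun _ => P) j
  have hsum : ((m : ENNReal) + 1) * (P.prod (Measure.pi fun _ : Fin m => P)) Ess =
      ∫⁻ T, ∑ j, (e j ⁻¹' Ess).indicator 1 T ∂(Measure.pi fun _ : Fin (m + 1) => P) := by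
    rw [lintegral_finsetSum _ fun j _ =>
      measurable_one.indicator ((he j).measurable hEss)]
    simp_rw [lintegral_indicator_one ((he _).measurable hEss),
      (he _).measure_preimage hEss.nullMeasurableSet]
    simp
  rw [hint, hsum]
  refine (lintegral_mono (g := fun _ => (Module.finrank ℝ (E × ℝ) : ENNReal)) fun T => ?_).trans
    (by simp)
  have hind : ∀ j, (e j ⁻¹' Ess).indicator (1 : (Fin (m + 1) → Ω) → ENNReal) T =
      if e j T ∈ Ess then 1 else 0 := fun j => by
    simp [Set.indicator_apply]
  simp only [hind]
  rw [Finset.sum_boole]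
  refine Nat.cast_le.2 (card_essential_le (strictQuasiconvex_lexKey hf.convex hf.strict)
    (fun i => {z | G z (T i) ≤ 0}) (fun i => hG.convex (T i)) (fun i => hG.down (T i)) _ ?_)
  intro j hj
  obtain ⟨hne, hpos⟩ : (optSet f G (e j T).2).Nonempty ∧
    0 < G (optPoint f G (e j T).2) (e j T).1 := (Finset.mem_filter.1 hj).2
  have hfeas : feasibleSet G (e j T).2 = ⋂ i ∈ ({j}ᶜ : Set (Fin (m + 1))), {z | G z (T i) ≤ 0} := by
    rw [← Fin.range_succAbove, Set.biInter_range]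
    rfl
  refine ⟨optPoint f G (e j T).2, ?_, not_le.2 hpos⟩
  rw [← hfeas]
  exact selectPoint_mem hne

/-- Subsamples are indexed by subtypes rather than `Fin m`; relabelling scenarios changes neither
the feasible set nor the product measure. -/
theorem lintegral_violation_optPoint_le (hG : IsScenarioConstraint G) (hf : IsConvexKey f)
    (ι : Type*) [Fintype ι] :
    ((Fintype.card ι : ENNReal) + 1) * ∫⁻ y in {y : ι → Ω | (optSet f G y).Nonempty},
      violation P G (optPoint f G y) ∂(Measure.pi fun _ => P) ≤ Module.finrank ℝ (E × ℝ) := by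
  refine le_trans (le_of_eq ?_) (lintegral_violation_optPoint_fin_le P hG hf (Fintype.card ι))
  congr 1
  let e := Fintype.equivFin ι
  have hmp := measurePreserving_piCongrLeft (α := fun _ : ι => Ω) (fun _ => P) e.symm
  have hopt : ∀ y : Fin (Fintype.card ι) → Ω,
      optSet f G (MeasurableEquiv.piCongrLeft (fun _ : ι => Ω) e.symm y) = optSet f G y := by
    intro y
    have : MeasurableEquiv.piCongrLeft (fun _ : ι => Ω) e.symm y = y ∘ e := by
      ext i
      obtain ⟨j, rfl⟩ := e.symm.surjective i
      simp [MeasurableEquiv.coe_piCongrLeft]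
    rw [this, optSet, optSet, feasibleSet_comp_surjective G y e.surjective]
  refine (hmp.setLIntegral_comp_preimage (measurableSet_optSet_nonempty hG hf)
    ((measurable_violation P hG).comp (measurable_optPoint hG hf))).symm.trans ?_
  simp only [Set.preimage_ofPred_eq, optPoint, hopt, Function.comp_apply]

end Scenario

/-! ### From the mean to a tail bound by random subsampling -/

section Exchange

variable {Ω E : Type*} [MeasurableSpace Ω] [NormedAddCommGroup E] [NormedSpace ℝ E]
  {G : E × ℝ → Ω → ℝ} {K : ℕ} {f : Fin (K + 1) → E × ℝ → ℝ}

/-- The weights `a ^ |J| * b ^ |Jᶜ|` of the sets `J ⊇ I` sum to `a ^ |I|` when `a + b = 1`. -/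
theorem sum_weight_superset {ι : Type*} [Fintype ι] [DecidableEq ι] {a b : ENNReal}
    (hab : a + b = 1) (I : Finset ι) :
    ∑ J ∈ (Finset.univ : Finset ι).powerset, a ^ J.card * b ^ (Fintype.card ι - J.card) *
      (if I ⊆ J then 1 else 0) = a ^ I.card := by
  -- Expanding this product with the `b`-terms set to `0` on `I` kills exactly the sets `J` not
  -- containing `I`.
  have h := Finset.prod_add (fun _ : ι => a) (fun i => if i ∈ I then 0 else b) Finset.univ
  have hl : ∏ i : ι, (a + if i ∈ I then 0 else b) = a ^ I.card := by
    have : ∀ i : ι, (a + if i ∈ I then 0 else b) = if i ∈ I then a else 1 := fun i => by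
      split_ifs <;> simp [hab]
    simp_rw [this]
    rw [Finset.prod_ite_mem, Finset.univ_inter, Finset.prod_const]
  rw [← hl, h]
  refine Finset.sum_congr rfl fun J _ => ?_
  rw [Finset.prod_const, mul_assoc]
  congr 1
  by_cases hIJ : I ⊆ J
  · rw [if_pos hIJ, mul_one, Finset.prod_congr rfl (g := fun _ => b), Finset.prod_const,
      ← Finset.compl_eq_univ_sdiff, Finset.card_compl]
    intro i hi
    exact if_neg fun hiI => (Finset.mem_sdiff.1 hi).2 (hIJ hiI)
  · obtain ⟨i, hiI, hiJ⟩ := Finset.not_subset.1 hIJ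
    rw [if_neg hIJ, mul_zero]
    exact (Finset.prod_eq_zero (Finset.mem_sdiff.2 ⟨Finset.mem_univ i, hiJ⟩) (by simp [hiI])).symm

/-- The identity `(N + 1) * N.choose m = (m + 1) * (N + 1).choose (m + 1)` absorbs the factor `1 /
(m + 1)`. What remains is the expansion of `(a + b * q) ^ (N + 1)` without its `a`-free term. -/
theorem sum_weight_card (N : ℕ) {a b q c e : ENNReal} (he : e ≠ 0) (he' : e ≠ ⊤) :
    (∑ J ∈ (Finset.univ : Finset (Fin N)).powerset, a ^ J.card * b ^ (N - J.card) *
      (q ^ (N - J.card) * c / (e * (J.card + 1)))) * ((N + 1) * e * a) ≤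
      c * (a + b * q) ^ (N + 1) := by
  rw [Finset.sum_powerset_apply_card
    (fun m => a ^ m * b ^ (N - m) * (q ^ (N - m) * c / (e * (m + 1)))), Finset.card_univ,
    Fintype.card_fin, Finset.sum_mul, add_pow, Finset.sum_range_succ' _ (N + 1), mul_add c,
    Finset.mul_sum]
  refine le_trans ?_ le_self_add
  refine Finset.sum_le_sum fun m hm => le_of_eq ?_
  have hchoose : (((N : ENNReal) + 1) * N.choose m) = (N + 1).choose (m + 1) * (m + 1) := by
    exact_mod_cast Nat.add_one_mul_choose_eq N m
  have hm1 : ((m : ENNReal) + 1) ≠ 0 := by simp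
  have hm2 : ((m : ENNReal) + 1) ≠ ⊤ := by finiteness
  have hcancel : q ^ (N - m) * c / (e * (m + 1)) * (e * (m + 1)) = q ^ (N - m) * c :=
    ENNReal.div_mul_cancel (mul_ne_zero he hm1) (ENNReal.mul_ne_top he' hm2)
  set D := q ^ (N - m) * c / (e * (m + 1))
  calc N.choose m • (a ^ m * b ^ (N - m) * D) * ((N + 1) * e * a)
      = (((N : ENNReal) + 1) * N.choose m) * (a ^ (m + 1) * b ^ (N - m) * e * D) := by
        rw [nsmul_eq_mul]
        ring
    _ = (N + 1).choose (m + 1) * (a ^ (m + 1) * b ^ (N - m)) * (D * (e * (m + 1))) := by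
        rw [hchoose]
        ring
    _ = c * (a ^ (m + 1) * (b * q) ^ (N + 1 - (m + 1)) * (N + 1).choose (m + 1)) := by
        rw [hcancel, Nat.add_sub_add_right, mul_pow]
        ring

/-- The event that the scenarios in `J` determine a decision with violation probability exceeding
`e`, and that all other scenarios satisfy it. -/
def subsampleEvent {ι : Type*} (P : Measure Ω) (f : Fin (K + 1) → E × ℝ → ℝ)
    (G : E × ℝ → Ω → ℝ) (e : ENNReal) (J : Finset ι) : Set (ι → Ω) :=
  {xs | ∃ z ∈ optSet f G (fun i : {i // i ∈ J} => xs i), e < violation P G z ∧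
    ∀ i ∉ J, G z (xs i) ≤ 0}

/-- The event that the scenarios of the first family determine a decision with violation
probability exceeding `e`, and that the scenarios of the second family satisfy it. -/
def determinedSet {κ κ' : Type*} (P : Measure Ω) (f : Fin (K + 1) → E × ℝ → ℝ)
    (G : E × ℝ → Ω → ℝ) (e : ENNReal) : Set ((κ → Ω) × (κ' → Ω)) :=
  {q | ((optSet f G q.1).Nonempty ∧ e < violation P G (optPoint f G q.1)) ∧
    ∀ i, G (optPoint f G q.1) (q.2 i) ≤ 0}

theorem subsampleEvent_eq_preimage (hG : IsScenarioConstraint G) (hf : IsConvexKey f) {ι : Type*}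
    [DecidableEq ι] (P : Measure Ω) (e : ENNReal) (J : Finset ι) :
    subsampleEvent P f G e J = MeasurableEquiv.piEquivPiSubtypeProd (fun _ : ι => Ω) (· ∈ J) ⁻¹'
      determinedSet P f G e := by
  ext xs
  constructor
  · rintro ⟨z, hz, hviol, hsat⟩
    have := optPoint_eq hG hf hz
    refine ⟨⟨⟨z, hz⟩, ?_⟩, fun i => ?_⟩
    · exact this.symm ▸ hviol
    · exact this.symm ▸ hsat i i.2
  · rintro ⟨⟨hne, hviol⟩, hsat⟩
    exact ⟨_, selectPoint_mem hne, hviol, fun i hi => hsat ⟨i, hi⟩⟩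

/-- An optimal decision of all scenarios with large violation probability is already determined
by every set of scenarios that contains a suitable small one. -/
theorem exists_basis_mem_subsampleEvent [FiniteDimensional ℝ E] (hG : IsScenarioConstraint G)
    (hf : IsConvexKey f) {ι : Type*} [Fintype ι] (P : Measure Ω) (e : ENNReal) {xs : ι → Ω}
    {z : E × ℝ} (hz : z ∈ optSet f G xs) (hviol : e < violation P G z) :
    ∃ I : Finset ι, I.card ≤ Module.finrank ℝ (E × ℝ) ∧
      ∀ J, I ⊆ J → xs ∈ subsampleEvent P f G e J := by
  obtain ⟨I, hI, hzI⟩ := exists_small_basis (strictQuasiconvex_lexKey hf.convex hf.strict)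
    (fun i => {z | G z (xs i) ≤ 0}) (fun i => hG.convex (xs i)) hz
  have hzmem : ∀ i, z ∈ {z | G z (xs i) ≤ 0} := Set.mem_iInter.1 hz.1
  refine ⟨I, hI, fun J hIJ => ⟨z, ?_, hviol, fun i _ => hzmem i⟩⟩
  refine keyMin_of_subset (fun w hw => ?_) hzI (Set.mem_iInter.2 fun i => hzmem i)
  exact Set.mem_iInter₂.2 fun i hi => Set.mem_iInter.1 hw ⟨i, hIJ hi⟩

variable [FiniteDimensional ℝ E] [MeasurableSpace E] [BorelSpace E]
  (P : Measure Ω) [IsProbabilityMeasure P]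

theorem measurableSet_determined (hG : IsScenarioConstraint G) (hf : IsConvexKey f)
    (e : ENNReal) (κ κ' : Type*) [Fintype κ] [Fintype κ'] :
    MeasurableSet (determinedSet (κ := κ) (κ' := κ') P f G e) := by
  have hopt := (measurable_optPoint hG hf (ι := κ)).comp
    (measurable_fst : Measurable (Prod.fst : (κ → Ω) × (κ' → Ω) → _))
  refine ((measurable_fst (measurableSet_optSet_nonempty hG hf)).inter
    (measurableSet_lt measurable_const ((measurable_violation P hG).comp hopt))).inter ?_
  have hset : {q : (κ → Ω) × (κ' → Ω) | ∀ i, G (optPoint f G q.1) (q.2 i) ≤ 0} =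
      ⋂ i, {q | G (optPoint f G q.1) (q.2 i) ≤ 0} := Set.ofPred_forall _
  change MeasurableSet {q : (κ → Ω) × (κ' → Ω) | ∀ i, G (optPoint f G q.1) (q.2 i) ≤ 0}
  rw [hset]
  exact MeasurableSet.iInter fun i => measurableSet_le (hG.measurable_uncurry.comp
    (hopt.prodMk ((measurable_pi_apply i).comp measurable_snd))) measurable_const

/-- Given the first family, independence bounds the chance that the second satisfies its decision by
`(1 - e) ^ card κ'`. The factor `1 / e` is Markov's inequality, applied to the leave-one-out bound
on the mean violation. -/
theorem measure_determinedSet_le (hG : IsScenarioConstraint G) (hf : IsConvexKey f)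
    {κ κ' : Type*} {_ : Fintype κ} {_ : Fintype κ'} {e : ENNReal} (he : e ≠ 0) (he' : e ≠ ⊤) :
    ((Measure.pi fun _ : κ => P).prod (Measure.pi fun _ : κ' => P)) (determinedSet P f G e) ≤
      (1 - e) ^ Fintype.card κ' * Module.finrank ℝ (E × ℝ) / (e * (Fintype.card κ + 1)) := by
  rw [Measure.prod_apply (measurableSet_determined P hG hf e κ κ')]
  have hpoint : ∀ y : κ → Ω,
      e * (Measure.pi fun _ : κ' => P) (Prod.mk y ⁻¹' determinedSet P f G e) ≤
      (1 - e) ^ Fintype.card κ' * {y | (optSet f G y).Nonempty}.indicator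
        (fun y => violation P G (optPoint f G y)) y := by
    intro y
    by_cases hy : (optSet f G y).Nonempty ∧ e < violation P G (optPoint f G y)
    · have hset : Prod.mk y ⁻¹' determinedSet (κ' := κ') P f G e =
          Set.univ.pi fun _ => {ω | 0 < G (optPoint f G y) ω}ᶜ := by
        ext w
        simp [determinedSet, hy]
      have hsat : P {ω | 0 < G (optPoint f G y) ω}ᶜ ≤ 1 - e := by
        rw [prob_compl_eq_one_sub (measurableSet_lt measurable_const (hG.measurable _))]
        exact tsub_le_tsub_left hy.2.le 1
      rw [hset, Measure.pi_pi, Finset.prod_const, Finset.card_univ,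
        Set.indicator_of_mem (by exact hy.1), mul_comm]
      exact mul_le_mul' (pow_le_pow_left' hsat _) hy.2.le
    · have hset : Prod.mk y ⁻¹' determinedSet (κ' := κ') P f G e = ∅ := by
        ext w
        simp [determinedSet, hy]
      rw [hset, measure_empty, mul_zero]
      exact zero_le
  have hmul : e * ∫⁻ y : κ → Ω, (Measure.pi fun _ : κ' => P) (Prod.mk y ⁻¹'
      determinedSet P f G e) ∂(Measure.pi fun _ => P) ≤
      (1 - e) ^ Fintype.card κ' * ∫⁻ y in {y : κ → Ω |
        (optSet f G y).Nonempty}, violation P G (optPoint f G y) ∂(Measure.pi fun _ => P) := by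
    rw [← lintegral_const_mul' _ _ he', ← lintegral_indicator (measurableSet_optSet_nonempty hG hf),
      ← lintegral_const_mul' _ _ (by finiteness)]
    exact lintegral_mono hpoint
  have hexp := lintegral_violation_optPoint_le P hG hf κ
  rw [ENNReal.le_div_iff_mul_le (Or.inl (mul_ne_zero he (by simp))) (Or.inl (by finiteness)),
    ← mul_assoc, mul_comm _ e]
  refine (mul_le_mul' hmul le_rfl).trans ?_
  rw [mul_assoc, mul_comm (lintegral _ _)]
  exact mul_le_mul' le_rfl hexp

theorem measure_subsampleEvent_le (hG : IsScenarioConstraint G) (hf : IsConvexKey f)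
    {ι : Type*} [Fintype ι] [DecidableEq ι] {e : ENNReal} (he : e ≠ 0) (he' : e ≠ ⊤)
    (J : Finset ι) :
    (Measure.pi fun _ : ι => P) (subsampleEvent P f G e J) ≤
      (1 - e) ^ (Fintype.card ι - J.card) * Module.finrank ℝ (E × ℝ) / (e * (J.card + 1)) := by
  rw [subsampleEvent_eq_preimage hG hf,
    (measurePreserving_piEquivPiSubtypeProd (fun _ : ι => P) (· ∈ J)).measure_preimage
      (measurableSet_determined P hG hf e _ _).nullMeasurableSet]
  refine (measure_determinedSet_le P hG hf he he').trans_eq ?_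
  have hJ : ∀ inst : Fintype {i // i ∈ J}, @Fintype.card _ inst = J.card := fun _ =>
    Fintype.card_of_subtype J fun _ => Iff.rfl
  have hJ' : ∀ inst : Fintype {i // i ∉ J}, @Fintype.card _ inst = Fintype.card ι - J.card :=
    fun _ => by rw [Fintype.card_subtype_compl, Fintype.card_coe]
  simp only [hJ, hJ']

/-- Tail bound for the violation probability of the optimal decision of `N` scenarios. -/
theorem measure_violation_gt_le (hG : IsScenarioConstraint G) (hf : IsConvexKey f) (N : ℕ)
    {e a b : ENNReal} (he : e ≠ 0) (he' : e ≠ ⊤) (hab : a + b = 1) :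
    a ^ Module.finrank ℝ (E × ℝ) * (Measure.pi fun _ : Fin N => P)
      {xs | ∃ z ∈ optSet f G xs, e < violation P G z} * ((N + 1) * e * a) ≤
      Module.finrank ℝ (E × ℝ) * (a + b * (1 - e)) ^ (N + 1) := by
  refine le_trans (mul_le_mul' ?_ le_rfl) (sum_weight_card N he he')
  have hmeas : ∀ J : Finset (Fin N), MeasurableSet (subsampleEvent P f G e J) := fun J => by
    rw [subsampleEvent_eq_preimage hG hf]
    exact (MeasurableEquiv.measurable _) (measurableSet_determined P hG hf e _ _)
  have ha : a ≤ 1 := hab ▸ le_self_add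
  -- The probability of `subsampleEvent` over a random `J` that keeps each scenario with probability
  -- `a`. A bad sample has `W` at least `a ^ finrank`, since every `J` containing a basis counts;
  -- Markov for `W` follows.
  let W : (Fin N → Ω) → ENNReal := fun xs => ∑ J ∈ (Finset.univ : Finset (Fin N)).powerset,
    a ^ J.card * b ^ (N - J.card) * (subsampleEvent P f G e J).indicator 1 xs
  have hW : Measurable W := Finset.measurable_sum _ fun J _ =>
    measurable_const.mul (measurable_one.indicator (hmeas J))
  have hsub : {xs : Fin N → Ω | ∃ z ∈ optSet f G xs, e < violation P G z} ⊆
      {xs | a ^ Module.finrank ℝ (E × ℝ) ≤ W xs} := by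
    rintro xs ⟨z, hz, hviol⟩
    obtain ⟨I, hI, hIJ⟩ := exists_basis_mem_subsampleEvent hG hf P e hz hviol
    refine (pow_le_pow_right_of_le_one' ha hI).trans ?_
    rw [← sum_weight_superset hab I, Fintype.card_fin]
    refine Finset.sum_le_sum fun J _ => mul_le_mul' le_rfl ?_
    split_ifs with h
    · rw [Set.indicator_of_mem (hIJ J h)]
      exact le_rfl
    · exact zero_le
  refine (mul_le_mul' le_rfl (measure_mono hsub)).trans
    ((mul_meas_ge_le_lintegral hW _).trans ?_)
  refine (lintegral_finsetSum _ fun J _ =>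
    measurable_const.mul (measurable_one.indicator (hmeas J))).trans_le ?_
  refine Finset.sum_le_sum fun J _ => ?_
  refine (lintegral_const_mul _ (measurable_one.indicator (hmeas J))).trans_le ?_
  rw [lintegral_indicator_one (hmeas J)]
  have := measure_subsampleEvent_le P hG hf he he' J
  rw [Fintype.card_fin] at this
  exact mul_le_mul' le_rfl this

end Exchange

/-! ### Numerical estimates for the sample size -/

section Numeric

theorem two_pow_mul_le_exp {k : ℕ} (hk : 3 ≤ k) :
    (2 : ℝ) ^ k * k ^ (k + 1) * Real.exp 2 ≤ Real.exp k * (k + 1) ^ (k + 1) := by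
  have he : (2.7 : ℝ) < Real.exp 1 := by
    have := Real.exp_one_gt_d9
    linarith
  -- Only a case split: the factor `2 ^ k * exp 1 ≤ exp k` used for larger `k` fails at `k = 3`. The
  -- claim itself fails at `k = 2`, where it would need `32 ≤ 27`.
  induction k, hk using Nat.le_induction with
  | base =>
    have h3 : Real.exp ((3 : ℕ) : ℝ) = Real.exp 2 * Real.exp 1 := by
      rw [← Real.exp_add]
      norm_num
    rw [h3]
    have := Real.exp_pos 2
    norm_num
    nlinarith
  | succ k hk _ =>
    have hfour : ∀ k : ℕ, 4 ≤ k → (2 : ℝ) ^ k * Real.exp 1 ≤ Real.exp k := by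
      intro k hk
      induction k, hk using Nat.le_induction with
      | base =>
        have h4 : Real.exp ((4 : ℕ) : ℝ) = Real.exp 1 ^ 3 * Real.exp 1 := by
          rw [← Real.exp_nat_mul, ← Real.exp_add]
          norm_num
        rw [h4]
        refine mul_le_mul_of_nonneg_right ?_ (Real.exp_pos 1).le
        calc (2 : ℝ) ^ 4 ≤ 2.7 ^ 3 := by norm_num
          _ ≤ _ := pow_le_pow_left₀ (by norm_num) he.le 3
      | succ k _ ih =>
        rw [Nat.cast_succ, Real.exp_add, pow_succ]
        nlinarith [Real.exp_pos k, Real.exp_pos 1]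
    have hk1 : (0 : ℝ) < (k + 1 : ℕ) + 1 := by positivity
    -- This is `exp 1 ≤ (1 + 1 / K) ^ (K + 1)` for `K = k + 1`.
    have hratio : ((k + 1 : ℕ) : ℝ) ^ (k + 1 + 1) * Real.exp 1 ≤
        ((k + 1 : ℕ) + 1) ^ (k + 1 + 1) := by
      have h1 : ((k + 1 : ℕ) : ℝ) * Real.exp (1 / ((k + 1 : ℕ) + 1)) ≤ (k + 1 : ℕ) + 1 := by
        have h2 := Real.add_one_le_exp (-(1 / (((k + 1 : ℕ) : ℝ) + 1)))
        have h3 : -(1 / (((k + 1 : ℕ) : ℝ) + 1)) + 1 = ((k + 1 : ℕ) : ℝ) / ((k + 1 : ℕ) + 1) := by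
          field_simp
          ring
        rw [h3, Real.exp_neg, div_le_iff₀ hk1] at h2
        have h4 := mul_le_mul_of_nonneg_right h2 (Real.exp_pos (1 / (((k + 1 : ℕ) : ℝ) + 1))).le
        rwa [mul_right_comm, inv_mul_cancel₀ (Real.exp_pos _).ne', one_mul] at h4
      have h5 := pow_le_pow_left₀ (by positivity) h1 (k + 1 + 1)
      rw [mul_pow, ← Real.exp_nat_mul] at h5
      have h6 : ((k + 1 + 1 : ℕ) : ℝ) * (1 / ((k + 1 : ℕ) + 1)) = 1 := by
        push_cast
        field_simp
      rwa [h6] at h5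
    have h4 := hfour (k + 1) (by omega)
    have hexp : Real.exp 2 = Real.exp 1 * Real.exp 1 := by
      rw [← Real.exp_add]
      norm_num
    rw [hexp]
    calc (2 : ℝ) ^ (k + 1) * ((k + 1 : ℕ) : ℝ) ^ (k + 1 + 1) * (Real.exp 1 * Real.exp 1)
        = (2 ^ (k + 1) * Real.exp 1) * (((k + 1 : ℕ) : ℝ) ^ (k + 1 + 1) * Real.exp 1) := by ring
      _ ≤ _ := mul_le_mul h4 hratio (by positivity) (Real.exp_pos _).le

/-- The bound at the retention probability `(k + 1) / μ`, where `μ = ε (N + 1)`. -/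
theorem scenario_tail_bound {k n : ℕ} (hk : 3 ≤ k) {ε δ : ℝ} (hε : 0 < ε) (hε1 : ε < 1)
    (hδ : 0 < δ) (hδ1 : δ < 1) (hn : 2 * (Real.log (1 / δ) + (k - 1)) ≤ ε * n) :
    ∃ α : ℝ, 0 < α ∧ α ≤ 1 ∧
      (k : ℝ) * (α + (1 - α) * (1 - ε)) ^ n ≤ δ * (α ^ k * (n * ε * α)) := by
  set L := Real.log (1 / δ) with hL
  have hL0 : 0 < L := Real.log_pos (by rw [lt_div_iff₀ hδ]; linarith)
  have hδL : δ = Real.exp (-L) := by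
    rw [hL, one_div, Real.log_inv, neg_neg, Real.exp_log hδ]
  have hk3 : (3 : ℝ) ≤ k := by exact_mod_cast hk
  set μ := ε * n with hμ
  have hμk : (k : ℝ) + 1 ≤ μ := by linarith
  have hμ0 : 0 < μ := by linarith
  -- After `1 - y ≤ exp (-y)` the bound depends on `α` through `exp (α μ) / α ^ (k + 1)`, which is
  -- least here. `k ≥ 3` enters through `μ ≥ 2 (k - 1) ≥ k + 1`, that is, `α ≤ 1`.
  refine ⟨(k + 1) / μ, by positivity, (div_le_one hμ0).2 hμk, ?_⟩
  have hbase : (k + 1) / μ + (1 - (k + 1) / μ) * (1 - ε) = 1 - (1 - (k + 1) / μ) * ε := by ring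
  have hα1 : (k + 1) / μ ≤ 1 := (div_le_one hμ0).2 hμk
  have hpow : (1 - (1 - (k + 1) / μ) * ε) ^ n ≤ Real.exp (k + 1 - μ) := by
    have h1 : 1 - (1 - (k + 1) / μ) * ε ≤ Real.exp (-((1 - (k + 1) / μ) * ε)) :=
      Real.one_sub_le_exp_neg _
    have h0 : 0 ≤ 1 - (1 - (k + 1) / μ) * ε := by
      have : 0 < (k + 1) / μ := by positivity
      nlinarith
    refine (pow_le_pow_left₀ h0 h1 n).trans_eq ?_
    rw [← Real.exp_nat_mul]
    congr 1
    have : (n : ℝ) * -((1 - (k + 1) / μ) * ε) = -((1 - (k + 1) / μ) * μ) := by rw [hμ]; ring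
    rw [this]
    field_simp
    ring
  -- `μ ^ k * exp (-μ / 2)` peaks at `μ = 2 k`. The other half of `exp (-μ)` is reserved for `δ`.
  have hμpow : μ ^ k * Real.exp k ≤ (2 * k) ^ k * Real.exp (μ / 2) := by
    have h1 := Real.add_one_le_exp (μ / (2 * k) - 1)
    rw [sub_add_cancel, div_le_iff₀ (by positivity)] at h1
    have h2 := pow_le_pow_left₀ hμ0.le h1 k
    rw [mul_pow (Real.exp _), ← Real.exp_nat_mul] at h2
    have h3 : (k : ℝ) * (μ / (2 * k) - 1) = μ / 2 - k := by field_simp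
    rw [h3] at h2
    calc μ ^ k * Real.exp k ≤ (Real.exp (μ / 2 - k) * (2 * k) ^ k) * Real.exp k :=
          mul_le_mul_of_nonneg_right h2 (Real.exp_pos _).le
      _ = (2 * k) ^ k * (Real.exp (μ / 2 - k) * Real.exp k) := by ring
      _ = _ := by rw [← Real.exp_add, sub_add_cancel]
  have hδμ : Real.exp (k - 1 - μ / 2) ≤ δ := by
    rw [hδL]
    exact Real.exp_le_exp.2 (by linarith)
  rw [hbase]
  have hrhs : ((k + 1) / μ) ^ k * (n * ε * ((k + 1) / μ)) = (k + 1) ^ (k + 1) / μ ^ k := by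
    have : (n : ℝ) * ε = μ := by rw [hμ]; ring
    rw [this, div_pow, pow_succ]
    field_simp
  rw [hrhs, ← mul_div_assoc, le_div_iff₀ (by positivity)]
  have hfinal := two_pow_mul_le_exp hk
  have hmain : (k : ℝ) * Real.exp (k + 1 - μ) * μ ^ k ≤
      Real.exp (k - 1 - μ / 2) * (k + 1) ^ (k + 1) := by
    have e1 : Real.exp ((k : ℝ) + 1 - μ) = Real.exp (-μ / 2) * Real.exp 2 *
        Real.exp (k - 1 - μ / 2) := by
      rw [← Real.exp_add, ← Real.exp_add]
      congr 1
      ring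
    have e2 : Real.exp (-μ / 2) * Real.exp (μ / 2) = 1 := by
      rw [← Real.exp_add, ← Real.exp_zero]
      congr 1
      ring
    have h1 : (k : ℝ) * Real.exp (-μ / 2) * Real.exp 2 * μ ^ k ≤ (k + 1) ^ (k + 1) := by
      refine le_of_mul_le_mul_right ?_ (Real.exp_pos k)
      calc (k : ℝ) * Real.exp (-μ / 2) * Real.exp 2 * μ ^ k * Real.exp k
          = (k * Real.exp (-μ / 2) * Real.exp 2) * (μ ^ k * Real.exp k) := by ring
        _ ≤ (k * Real.exp (-μ / 2) * Real.exp 2) * ((2 * k) ^ k * Real.exp (μ / 2)) :=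
          mul_le_mul_of_nonneg_left hμpow (by positivity)
        _ = (2 ^ k * k ^ (k + 1) * Real.exp 2) * (Real.exp (-μ / 2) * Real.exp (μ / 2)) := by
          rw [mul_pow]
          ring
        _ ≤ _ := by
          rw [e2, mul_one, mul_comm ((k + 1 : ℝ) ^ _)]
          exact hfinal
    calc (k : ℝ) * Real.exp (k + 1 - μ) * μ ^ k
        = (k * Real.exp (-μ / 2) * Real.exp 2 * μ ^ k) * Real.exp (k - 1 - μ / 2) := by
          rw [e1]
          ring
      _ ≤ (k + 1) ^ (k + 1) * Real.exp (k - 1 - μ / 2) :=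
          mul_le_mul_of_nonneg_right h1 (Real.exp_pos _).le
      _ = _ := mul_comm _ _
  calc (k : ℝ) * (1 - (1 - (k + 1) / μ) * ε) ^ n * μ ^ k
      ≤ k * Real.exp (k + 1 - μ) * μ ^ k := by gcongr
    _ ≤ _ := hmain
    _ ≤ _ := by gcongr

end Numeric

/-! ### The tail bound at the stated sample size -/

section TailBound

variable {Ω E : Type*} [MeasurableSpace Ω] [NormedAddCommGroup E] [NormedSpace ℝ E]
  [FiniteDimensional ℝ E] [MeasurableSpace E] [BorelSpace E]
  {G : E × ℝ → Ω → ℝ} {K : ℕ} {f : Fin (K + 1) → E × ℝ → ℝ}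

/-- With enough scenarios, the optimal decision has violation probability at most `ε` with
probability at least `1 - δ`. -/
theorem measure_violation_gt_le_of_le (P : Measure Ω) [IsProbabilityMeasure P]
    (hG : IsScenarioConstraint G) (hf : IsConvexKey f) (hdim : 3 ≤ Module.finrank ℝ (E × ℝ))
    {ε δ : ℝ} (hε : 0 < ε) (hε1 : ε < 1) (hδ : 0 < δ) (hδ1 : δ < 1) {N : ℕ}
    (hN : 2 * (Real.log (1 / δ) + (Module.finrank ℝ (E × ℝ) - 1)) / ε ≤ N) :
    (Measure.pi fun _ : Fin N => P)
      {xs | ∃ z ∈ optSet f G xs, ENNReal.ofReal ε < violation P G z} ≤ ENNReal.ofReal δ := by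
  set k := Module.finrank ℝ (E × ℝ)
  obtain ⟨α, hα, hα1, hbound⟩ := scenario_tail_bound (n := N + 1) hdim hε hε1 hδ hδ1 (by
    rw [div_le_iff₀ hε] at hN
    push_cast
    linarith)
  have h := measure_violation_gt_le P hG hf N (e := ENNReal.ofReal ε) (a := ENNReal.ofReal α)
    (b := ENNReal.ofReal (1 - α)) (ENNReal.ofReal_pos.2 hε).ne' ENNReal.ofReal_ne_top (by
      rw [← ENNReal.ofReal_add hα.le (by linarith), add_sub_cancel, ENNReal.ofReal_one])
  have hrhs : (k : ENNReal) * (ENNReal.ofReal α + ENNReal.ofReal (1 - α) *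
      (1 - ENNReal.ofReal ε)) ^ (N + 1) =
      ENNReal.ofReal (k * (α + (1 - α) * (1 - ε)) ^ (N + 1)) := by
    have h1 : 0 ≤ (1 - α) * (1 - ε) := mul_nonneg (by linarith) (by linarith)
    rw [← ENNReal.ofReal_one, ← ENNReal.ofReal_sub _ hε.le, ← ENNReal.ofReal_mul (by linarith),
      ← ENNReal.ofReal_add hα.le h1, ← ENNReal.ofReal_pow (by linarith),
      ← ENNReal.ofReal_natCast, ← ENNReal.ofReal_mul (by positivity)]
  have hlhs : ENNReal.ofReal α ^ k * ((N + 1) * ENNReal.ofReal ε * ENNReal.ofReal α) =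
      ENNReal.ofReal (α ^ k * ((N + 1 : ℕ) * ε * α)) := by
    rw [ENNReal.ofReal_mul (by positivity), ENNReal.ofReal_mul (by positivity),
      ENNReal.ofReal_mul (by positivity), ENNReal.ofReal_pow hα.le, ENNReal.ofReal_natCast]
    push_cast
    rfl
  have hpos : 0 < α ^ k * ((N + 1 : ℕ) * ε * α) := by positivity
  refine (ENNReal.mul_le_mul_iff_left (ENNReal.ofReal_pos.2 hpos).ne' ENNReal.ofReal_ne_top).1 ?_
  rw [← ENNReal.ofReal_mul hδ.le]
  refine le_trans (le_of_eq ?_) ((h.trans_eq hrhs).trans (ENNReal.ofReal_le_ofReal hbound))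
  rw [← hlhs]
  ring

end TailBound

/-! ### Linearity and continuity of the generator -/

section Generator

variable {n m k p : ℕ} {S : ControlSDE n m k} {π : Euc n → Euc k} {φ : Euc n → Fin p → ℝ}

theorem partialDeriv_linear_combination {ι : Type*} [Fintype ι] (i : Fin n) (c : ι → ℝ) (b : ℝ)
    {F : ι → Euc n → ℝ} {x : Euc n} (hF : ∀ l, DifferentiableAt ℝ (F l) x) :
    partialDeriv i (fun y => ∑ l, c l * F l y + b) x = ∑ l, c l * partialDeriv i (F l) x := by
  have h : HasFDerivAt (fun y => ∑ l, c l * F l y + b) (∑ l, c l • fderiv ℝ (F l) x) x :=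
    (HasFDerivAt.fun_sum fun l _ => (hF l).hasFDerivAt.const_mul (c l)).add_const b
  rw [partialDeriv, h.fderiv]
  simp [partialDeriv]

theorem ContDiffAt.partialDeriv {W : Euc n → ℝ} {x : Euc n} {a b : WithTop ℕ∞}
    (hW : ContDiffAt ℝ b W x) (hab : a + 1 ≤ b) (i : Fin n) :
    ContDiffAt ℝ a (partialDeriv i W) x :=
  (hW.fderiv_right hab).clm_apply contDiffAt_const

theorem generator_network {x : Euc n} (hφ : ContDiffAt ℝ 2 φ x) (θ : LastLayer p) :
    generator S π (network φ θ) x =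
      ∑ j : Fin p, θ j.castSucc * generator S π (fun y => φ y j) x := by
  have hφj : ∀ y, ContDiffAt ℝ 2 φ y → ∀ j, ContDiffAt ℝ 2 (fun y => φ y j) y :=
    fun y hy j => contDiffAt_pi.1 hy j
  have hfirst : ∀ y, ContDiffAt ℝ 2 φ y → ∀ i, partialDeriv i (network φ θ) y =
      ∑ j : Fin p, θ j.castSucc * partialDeriv i (fun y => φ y j) y + 0 := fun y hy i =>
    (partialDeriv_linear_combination i (fun j : Fin p => θ j.castSucc) (θ (Fin.last p))
      fun j => (hφj y hy j).differentiableAt (by norm_num)).trans (add_zero _).symm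
  have hsecond : ∀ i l, partialDeriv i (partialDeriv l (network φ θ)) x =
      ∑ j : Fin p, θ j.castSucc * partialDeriv i (partialDeriv l fun y => φ y j) x := by
    intro i l
    -- Differentiating again needs the first-order formula near `x`, not just at `x`; being `C²` at
    -- a point is an open condition.
    have hev : partialDeriv l (network φ θ) =ᶠ[nhds x]
        fun y => ∑ j : Fin p, θ j.castSucc * partialDeriv l (fun y => φ y j) y + 0 :=
      (hφ.eventually (by simp)).mono fun y hy => hfirst y hy l
    rw [partialDeriv, hev.fderiv_eq]
    exact partialDeriv_linear_combination i (fun j : Fin p => θ j.castSucc) 0 fun j =>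
      ((hφj x hφ j).partialDeriv (a := 1) (by norm_num) l).differentiableAt (by norm_num)
  simp only [generator, hfirst x hφ, hsecond, add_zero, mul_add, Finset.sum_add_distrib,
    Finset.mul_sum]
  congr 1
  · rw [Finset.sum_comm]
    exact Finset.sum_congr rfl fun j _ => Finset.sum_congr rfl fun i _ => by ring
  · refine (Finset.sum_congr rfl fun i _ => ?_).trans Finset.sum_comm
    rw [Finset.sum_comm]
    exact Finset.sum_congr rfl fun j _ => Finset.sum_congr rfl fun i _ => by ring

theorem continuous_drift (hπ : IsController S π) : Continuous fun x => S.f x (π x) := by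
  refine (LipschitzWith.of_dist_le' (K := S.L * (1 + S.L)) fun x y => ?_).continuous
  rw [dist_eq_norm, dist_eq_norm]
  calc _ ≤ S.L * (‖x - y‖ + ‖π x - π y‖) :=
        S.lipschitz_f x y _ (hπ.mem_U x) _ (hπ.mem_U y)
    _ ≤ S.L * (‖x - y‖ + S.L * ‖x - y‖) :=
        mul_le_mul_of_nonneg_left (add_le_add_right (hπ.lipschitz x y) _) S.L_pos.le
    _ = _ := by ring

theorem continuous_diffusion (S : ControlSDE n m k) : Continuous S.g := by
  refine continuous_matrix fun i j => ?_
  refine (LipschitzWith.of_dist_le' (K := S.L) fun x y => ?_).continuous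
  rw [dist_eq_norm, dist_eq_norm]
  refine le_trans (Real.le_sqrt_of_sq_le ?_) (S.lipschitz_g x y)
  rw [Real.norm_eq_abs, sq_abs]
  refine le_trans ?_ (Finset.single_le_sum (f := fun i => ∑ j, (S.g x i j - S.g y i j) ^ 2)
    (fun i _ => Finset.sum_nonneg fun j _ => sq_nonneg _) (Finset.mem_univ i))
  exact Finset.single_le_sum (f := fun j => (S.g x i j - S.g y i j) ^ 2)
    (fun j _ => sq_nonneg _) (Finset.mem_univ j)

theorem continuousAt_generator (hπ : IsController S π) {W : Euc n → ℝ} {x : Euc n}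
    (hW : ContDiffAt ℝ 2 W x) : ContinuousAt (generator S π W) x := by
  have h1 : ∀ i, ContinuousAt (partialDeriv i W) x := fun i =>
    (hW.partialDeriv (a := 1) (by norm_num) i).continuousAt
  have h2 : ∀ i j, ContinuousAt (partialDeriv i (partialDeriv j W)) x := fun i j =>
    ((hW.partialDeriv (a := 1) (by norm_num) j).partialDeriv (a := 0) (by norm_num) i).continuousAt
  have hf : ∀ i, Continuous fun x => S.f x (π x) i := fun i =>
    (EuclideanSpace.proj (𝕜 := ℝ) i).continuous.comp (continuous_drift hπ)
  have hg : ∀ i j, Continuous fun x => (S.g x * (S.g x).transpose) i j := fun i j =>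
    ((continuous_diffusion S).matrix_mul (continuous_diffusion S).matrix_transpose).matrix_elem i j
  refine ContinuousAt.add (tendsto_finsetSum _ fun i _ => ?_)
    (continuousAt_const.mul (tendsto_finsetSum _ fun i _ => tendsto_finsetSum _ fun j _ => ?_))
  · exact (hf i).continuousAt.mul (h1 i)
  · exact (hg i j).continuousAt.mul (h2 i j)

end Generator

/-! ### The constraint function as a convex scenario constraint -/

section ConstraintFn

variable {n m k p : ℕ} {S : ControlSDE n m k} {π : Euc n → Euc k} {R : ReachAvoidSets n}
  {φ : Euc n → Fin p → ℝ} {εgen : ℝ}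

/-- The linear functional `(θ, β) ↦ ∑ j, c j * θ j + b * θ p`. -/
def lastLayerForm (c : Fin p → ℝ) (b : ℝ) : (LastLayer p × ℝ) →ₗ[ℝ] ℝ :=
  (∑ j : Fin p, c j • LinearMap.proj j.castSucc + b • LinearMap.proj (Fin.last p)) ∘ₗ
    LinearMap.fst ℝ (LastLayer p) ℝ

theorem lastLayerForm_apply (c : Fin p → ℝ) (b : ℝ) (z : LastLayer p × ℝ) :
    lastLayerForm c b z = ∑ j : Fin p, c j * z.1 j.castSucc + b * z.1 (Fin.last p) := by
  simp [lastLayerForm]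

/-- The left-hand sides of the affine inequalities `h(z, x) ≤ 0` consists of. -/
noncomputable def constraintForms (S : ControlSDE n m k) (π : Euc n → Euc k) (R : ReachAvoidSets n)
    (φ : Euc n → Fin p → ℝ) (x : Euc n) : Fin 4 → (LastLayer p × ℝ) →ₗ[ℝ] ℝ :=
  ![-lastLayerForm (φ x) 1, ind R.X0 x • lastLayerForm (φ x) 1,
    ind R.Xu x • (LinearMap.snd ℝ (LastLayer p) ℝ - lastLayerForm (φ x) 1),
    ind R.Xgen x • lastLayerForm (fun j => generator S π (fun y => φ y j) x) 0]

/-- The right-hand sides of the affine inequalities `h(z, x) ≤ 0` consists of. -/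
noncomputable def constraintBounds (R : ReachAvoidSets n) (εgen : ℝ) (x : Euc n) : Fin 4 → ℝ :=
  ![0, ind R.X0 x, 0, -(ind R.Xgen x * εgen)]

theorem ind_nonneg (A : Set (Euc n)) (x : Euc n) : 0 ≤ ind A x :=
  Set.indicator_nonneg (fun _ _ => zero_le_one) x

theorem ind_of_mem {A : Set (Euc n)} {x : Euc n} (h : x ∈ A) : ind A x = 1 :=
  Set.indicator_of_mem h _

theorem ind_of_notMem {A : Set (Euc n)} {x : Euc n} (h : x ∉ A) : ind A x = 0 :=
  Set.indicator_of_notMem h _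

/-- Indicators are nonnegative, so they move inside the ReLU. Off the relevant set the affine
inequality degenerates to `0 ≤ 0`. -/
theorem constraintFn_eq_sum {x : Euc n} (hφ : ContDiffAt ℝ 2 φ x) (z : LastLayer p × ℝ) :
    constraintFn S π R φ εgen z.1 z.2 x =
      ∑ i, max 0 (constraintForms S π R φ x i z - constraintBounds R εgen x i) := by
  have hrelu : ∀ (A : Set (Euc n)) (y : ℝ), ind A x * relu y = max 0 (ind A x * y) := by
    intro A y
    rw [relu, mul_max_of_nonneg _ _ (ind_nonneg A x), mul_zero]
  have hnet : network φ z.1 x = lastLayerForm (φ x) 1 z := by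
    rw [lastLayerForm_apply, network, one_mul]
    simp only [mul_comm]
  have hgen : generator S π (network φ z.1) x =
      lastLayerForm (fun j => generator S π (fun y => φ y j) x) 0 z := by
    rw [lastLayerForm_apply, generator_network hφ, zero_mul, add_zero]
    simp only [mul_comm]
  rw [constraintFn, hrelu, hrelu, hrelu, hnet, hgen, Fin.sum_univ_four]
  simp [constraintForms, constraintBounds, relu, mul_sub, mul_add]

theorem constraintFn_nonpos_iff {x : Euc n} (hφ : ContDiffAt ℝ 2 φ x) (z : LastLayer p × ℝ) :
    constraintFn S π R φ εgen z.1 z.2 x ≤ 0 ↔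
      ∀ i, constraintForms S π R φ x i z ≤ constraintBounds R εgen x i := by
  have hnn : ∀ i ∈ Finset.univ,
      0 ≤ max 0 (constraintForms S π R φ x i z - constraintBounds R εgen x i) :=
    fun i _ => le_max_left _ _
  rw [constraintFn_eq_sum hφ, (Finset.sum_nonneg hnn).ge_iff_eq',
    Finset.sum_eq_zero_iff_of_nonneg hnn]
  simp

theorem isLinearProgram_scenario {N : ℕ} {xs : Fin N → Euc n}
    (hφ : ∀ i, ContDiffAt ℝ 2 φ (xs i)) :
    IsLinearProgram (E := LastLayer p × ℝ) scenarioObjective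
      (scenarioFeasible S π R φ εgen xs) := by
  refine ⟨⟨-LinearMap.snd ℝ (LastLayer p) ℝ, fun z => rfl⟩, Fintype.card (Fin N × Fin 4),
    fun q => constraintForms S π R φ (xs ((Fintype.equivFin _).symm q).1)
      ((Fintype.equivFin _).symm q).2,
    fun q => constraintBounds R εgen (xs ((Fintype.equivFin _).symm q).1)
      ((Fintype.equivFin _).symm q).2, ?_⟩
  ext z
  simp only [scenarioFeasible, Set.mem_ofPred_eq, constraintFn_nonpos_iff (hφ _)]
  rw [(Fintype.equivFin (Fin N × Fin 4)).symm.forall_congr_left]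
  simp [Prod.forall]

/-- The constraint function, set to `0` outside `X`. -/
noncomputable def domainConstraint (S : ControlSDE n m k) (π : Euc n → Euc k)
    (R : ReachAvoidSets n) (φ : Euc n → Fin p → ℝ) (εgen : ℝ) (z : LastLayer p × ℝ) :
    Euc n → ℝ :=
  R.X.indicator fun x => constraintFn S π R φ εgen z.1 z.2 x

theorem measurable_indicator_of_continuousOn {α : Type*} [TopologicalSpace α] [MeasurableSpace α]
    [BorelSpace α] {A : Set α} (hA : MeasurableSet A) {u : α → ℝ} (hu : ContinuousOn u A) :
    Measurable (A.indicator u) := by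
  classical
  rw [← Set.piecewise_eq_indicator]
  exact hu.measurable_piecewise continuousOn_const hA

theorem ReachAvoidSets.measurableSet_Xu (R : ReachAvoidSets n) : MeasurableSet R.Xu :=
  R.isCompact_X.measurableSet.diff isOpen_interior.measurableSet

theorem measurable_ind {A : Set (Euc n)} (hA : MeasurableSet A) : Measurable (ind A) :=
  measurable_const.indicator hA

/-- The features are regular only around points of `X`, so the network and its generator are cut off
to `X`, where they are continuous, before being composed. -/
theorem measurable_domainConstraint (hπ : IsController S π)
    (hφ : ∀ x ∈ R.X, ContDiffAt ℝ 2 φ x) (z : LastLayer p × ℝ) :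
    Measurable (domainConstraint S π R φ εgen z) := by
  have hX := R.isCompact_X.measurableSet
  have hφj : ∀ x ∈ R.X, ∀ j, ContDiffAt ℝ 2 (fun y => φ y j) x :=
    fun x hx j => contDiffAt_pi.1 (hφ x hx) j
  have hA : Measurable (R.X.indicator (network φ z.1)) := by
    refine measurable_indicator_of_continuousOn hX fun x hx => ContinuousAt.continuousWithinAt ?_
    exact ContinuousAt.add (tendsto_finsetSum _ fun j _ =>
      continuousAt_const.mul (hφj x hx j).continuousAt) continuousAt_const
  have hB : Measurable (R.X.indicator (generator S π (network φ z.1))) := by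
    refine measurable_indicator_of_continuousOn hX fun x hx => ContinuousAt.continuousWithinAt ?_
    have hnet : ContDiffAt ℝ 2 (network φ z.1) x :=
      (ContDiffAt.sum fun j _ => contDiffAt_const.mul (hφj x hx j)).add contDiffAt_const
    exact continuousAt_generator hπ hnet
  have hX0 := measurable_ind R.isCompact_X0.measurableSet
  have hXu := measurable_ind R.measurableSet_Xu
  have hXgen : Measurable (ind R.Xgen) := measurable_ind (hX.diff isOpen_interior.measurableSet)
  have hrelu : Measurable relu := measurable_const.max measurable_id
  have hmain := (((hrelu.comp hA.neg).add (hX0.mul (hrelu.comp (hA.sub_const 1)))).add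
    (hXu.mul (hrelu.comp (hA.const_sub z.2)))).add (hXgen.mul (hrelu.comp (hB.add_const εgen)))
  convert hmain.indicator hX using 1
  ext x
  by_cases hx : x ∈ R.X
  · simp [domainConstraint, constraintFn, hx]
  · simp [domainConstraint, hx]

theorem isScenarioConstraint_domainConstraint (hπ : IsController S π)
    (hφ : ∀ x ∈ R.X, ContDiffAt ℝ 2 φ x) :
    IsScenarioConstraint (domainConstraint S π R φ εgen) where
  measurable := measurable_domainConstraint hπ hφ
  continuous x := by
    by_cases hx : x ∈ R.X
    · simp only [domainConstraint, Set.indicator_of_mem hx, constraintFn_eq_sum (hφ x hx)]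
      exact continuous_finsetSum _ fun i _ => continuous_const.max
        ((LinearMap.continuous_of_finiteDimensional _).sub continuous_const)
    · simp only [domainConstraint, Set.indicator_of_notMem hx]
      exact continuous_const
  convex x := by
    by_cases hx : x ∈ R.X
    · simp only [domainConstraint, Set.indicator_of_mem hx, constraintFn_nonpos_iff (hφ x hx)]
      rw [Set.ofPred_forall]
      exact convex_iInter fun i => convex_halfSpace_le (LinearMap.isLinear _) _
    · simp only [domainConstraint, Set.indicator_of_notMem hx, le_refl]
      exact convex_univ
  down x θ β β' hβ h := by
    by_cases hx : x ∈ R.X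
    · simp only [domainConstraint, Set.indicator_of_mem hx] at h ⊢
      refine le_trans ?_ h
      have hle : relu (β' - network φ θ x) ≤ relu (β - network φ θ x) :=
        max_le_max le_rfl (by linarith)
      have := mul_le_mul_of_nonneg_left hle (ind_nonneg R.Xu x)
      simp only [constraintFn]
      linarith
    · simp only [domainConstraint, Set.indicator_of_notMem hx, le_refl]

theorem scenarioFeasible_eq_feasibleSet {N : ℕ} {xs : Fin N → Euc n} (hxs : ∀ i, xs i ∈ R.X) :
    scenarioFeasible S π R φ εgen xs = feasibleSet (domainConstraint S π R φ εgen) xs := by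
  ext z
  simp [scenarioFeasible, feasibleSet, domainConstraint, hxs]

theorem measure_constraintFn_pos_le {P : Measure (Euc n)} (hP : P R.Xᶜ = 0)
    (z : LastLayer p × ℝ) :
    P {x | 0 < constraintFn S π R φ εgen z.1 z.2 x} ≤
      violation P (domainConstraint S π R φ εgen) z := by
  refine (measure_mono (t := {x | 0 < domainConstraint S π R φ εgen z x} ∪ R.Xᶜ) ?_).trans
    ((measure_union_le _ _).trans (by rw [hP, add_zero]; exact le_rfl))
  intro x hx
  by_cases hxX : x ∈ R.X
  · refine Or.inl ?_
    change 0 < domainConstraint S π R φ εgen z x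
    rw [domainConstraint, Set.indicator_of_mem hxX]
    exact hx
  · exact Or.inr hxX

end ConstraintFn

/-! ### The strictly convex final key -/

section TieBreak

/-- The squared Euclidean norm of the decision variable. -/
def decisionSqNorm {p : ℕ} (z : LastLayer p × ℝ) : ℝ := ∑ j, z.1 j ^ 2 + z.2 ^ 2

theorem decisionSqNorm_pos {p : ℕ} {z : LastLayer p × ℝ} (hz : z ≠ 0) : 0 < decisionSqNorm z := by
  refine lt_of_le_of_ne (by unfold decisionSqNorm; positivity) fun h => hz ?_
  have h1 : 0 ≤ ∑ j, z.1 j ^ 2 := by positivity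
  have h2 : 0 ≤ z.2 ^ 2 := by positivity
  rw [decisionSqNorm] at h
  have h3 : ∑ j, z.1 j ^ 2 = 0 := by linarith
  have h4 : z.2 ^ 2 = 0 := by linarith
  rw [Finset.sum_eq_zero_iff_of_nonneg fun j _ => sq_nonneg _] at h3
  exact Prod.ext (funext fun j => pow_eq_zero_iff two_ne_zero |>.1 (h3 j (Finset.mem_univ j)))
    (pow_eq_zero_iff two_ne_zero |>.1 h4)

theorem strictConvexOn_decisionSqNorm {p : ℕ} :
    StrictConvexOn ℝ Set.univ (decisionSqNorm (p := p)) := by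
  refine ⟨convex_univ, fun x _ y _ hne a b ha hb hab => ?_⟩
  have hpos := decisionSqNorm_pos (sub_ne_zero.2 hne)
  have hid : decisionSqNorm (a • x + b • y) =
      a * decisionSqNorm x + b * decisionSqNorm y - a * b * decisionSqNorm (x - y) := by
    obtain rfl : b = 1 - a := by linarith
    simp only [decisionSqNorm, Prod.fst_add, Prod.snd_add, Prod.smul_fst, Prod.smul_snd,
      Prod.fst_sub, Prod.snd_sub, Pi.add_apply, Pi.smul_apply, Pi.sub_apply, smul_eq_mul, mul_add,
      Finset.mul_sum]
    rw [add_add_add_comm, ← Finset.sum_add_distrib, add_sub_add_comm, ← Finset.sum_sub_distrib]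
    congr 1
    · exact Finset.sum_congr rfl fun j _ => by ring
    · ring
  rw [hid, smul_eq_mul, smul_eq_mul]
  have := mul_pos (mul_pos ha hb) hpos
  linarith

theorem isConvexKey_scenarioKeys {p r : ℕ} {t : Fin r → LastLayer p × ℝ → ℝ}
    (ht : ∀ i, ConvexOn ℝ Set.univ (t i)) :
    IsConvexKey (scenarioKeys scenarioObjective t decisionSqNorm) := by
  have hlast : scenarioKeys scenarioObjective t decisionSqNorm (Fin.last (r + 1)) =
      decisionSqNorm := Fin.snoc_last (α := fun _ => LastLayer p × ℝ → ℝ) _ _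
  have hconv : ∀ i, ConvexOn ℝ Set.univ (scenarioKeys scenarioObjective t decisionSqNorm i) := by
    intro i
    refine Fin.lastCases ?_ (fun i => ?_) i
    · rw [hlast]
      exact strictConvexOn_decisionSqNorm.convexOn
    · have hcast : scenarioKeys scenarioObjective t decisionSqNorm i.castSucc =
          Fin.cons (α := fun _ => LastLayer p × ℝ → ℝ) scenarioObjective t i :=
        Fin.snoc_castSucc (α := fun _ => LastLayer p × ℝ → ℝ) _ _ _
      rw [hcast]
      refine Fin.cases ?_ (fun i => ?_) i
      · exact (-LinearMap.snd ℝ (LastLayer p) ℝ).convexOn convex_univ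
      · exact ht i
  -- Continuity of the tie-break functions comes for free: finite convex functions on a
  -- finite-dimensional space are continuous.
  exact ⟨fun i => continuousOn_univ.1 ((hconv i).continuousOn isOpen_univ), hconv,
    by rw [hlast]; exact strictConvexOn_decisionSqNorm⟩

end TieBreak

/-! ### Networks without features (`p = 0`) -/

section ConstantNetwork

variable {n m k : ℕ} {S : ControlSDE n m k} {π : Euc n → Euc k} {R : ReachAvoidSets n}
  {φ : Euc n → Fin 0 → ℝ} {εgen : ℝ}

theorem constraintFn_constant_nonpos_iff {x : Euc n} (hφ : ContDiffAt ℝ 2 φ x)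
    (hεgen : 0 < εgen) (z : LastLayer 0 × ℝ) :
    constraintFn S π R φ εgen z.1 z.2 x ≤ 0 ↔
      0 ≤ z.1 0 ∧ (x ∈ R.X0 → z.1 0 ≤ 1) ∧ (x ∈ R.Xu → z.2 ≤ z.1 0) ∧ x ∉ R.Xgen := by
  have h0 : ∀ A : Set (Euc n), ∀ y : ℝ, ind A x * relu y ≤ 0 ↔ (x ∈ A → y ≤ 0) := by
    intro A y
    by_cases h : x ∈ A <;> simp [ind_of_mem, ind_of_notMem, h, relu]
  have hnn : ∀ A : Set (Euc n), ∀ y : ℝ, 0 ≤ ind A x * relu y := fun A y =>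
    mul_nonneg (ind_nonneg A x) (le_max_left _ _)
  have hnet : network φ z.1 x = z.1 0 := by simp [network]
  have hgen : generator S π (network φ z.1) x = 0 := by simp [generator_network hφ]
  have hr : relu (-z.1 0) ≤ 0 ↔ 0 ≤ z.1 0 := by simp [relu]
  have hr0 : 0 ≤ relu (-z.1 0) := le_max_left _ _
  have h1 := h0 R.X0 (z.1 0 - 1)
  have h2 := h0 R.Xu (z.2 - z.1 0)
  have h3 := h0 R.Xgen (0 + εgen)
  have h1' := hnn R.X0 (z.1 0 - 1)
  have h2' := hnn R.Xu (z.2 - z.1 0)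
  have h3' := hnn R.Xgen (0 + εgen)
  rw [constraintFn, hnet, hgen]
  rw [sub_nonpos] at h1 h2
  rw [zero_add εgen, imp_iff_not (not_le.2 hεgen)] at h3
  rw [← hr, ← h1, ← h2, ← h3, zero_add εgen]
  rw [zero_add εgen] at h3'
  constructor
  · intro h
    refine ⟨?_, ?_, ?_, ?_⟩ <;> linarith
  · rintro ⟨a, b, c, d⟩
    linarith

/-- Optimality forces a sample in `X0`, else bias and `β` could rise together, and one in `Xu`, else
`β` alone could rise. Hence `β ≤ bias ≤ 1`, while `(1, 1)` is feasible and gives `β ≥ 1`. -/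
theorem eq_one_of_mem_argminSet_constant {N : ℕ} {xs : Fin N → Euc n}
    (hφ : ∀ i, ContDiffAt ℝ 2 φ (xs i)) (hεgen : 0 < εgen) {z : LastLayer 0 × ℝ}
    (hz : z ∈ argminSet scenarioObjective (scenarioFeasible S π R φ εgen xs)) :
    z = (fun _ => 1, 1) := by
  obtain ⟨hfeas, hmin⟩ := hz
  have hiff := fun (z : LastLayer 0 × ℝ) i =>
    constraintFn_constant_nonpos_iff (S := S) (π := π) (R := R) (hφ i) hεgen z
  have hF : ∀ i, 0 ≤ z.1 0 ∧ (xs i ∈ R.X0 → z.1 0 ≤ 1) ∧ (xs i ∈ R.Xu → z.2 ≤ z.1 0) ∧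
      xs i ∉ R.Xgen := fun i => (hiff z i).1 (hfeas i)
  have hle : ∀ z' : LastLayer 0 × ℝ, (∀ i, 0 ≤ z'.1 0 ∧ (xs i ∈ R.X0 → z'.1 0 ≤ 1) ∧
      (xs i ∈ R.Xu → z'.2 ≤ z'.1 0) ∧ xs i ∉ R.Xgen) → z'.2 ≤ z.2 := fun z' h =>
    neg_le_neg_iff.1 (hmin z' fun i => (hiff z' i).2 (h i))
  have hX0 : ∃ i, xs i ∈ R.X0 := by
    by_contra hno
    push Not at hno
    have := hle (fun _ => z.1 0 + 1, z.2 + 1) fun i =>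
      ⟨by linarith [(hF i).1], fun h => absurd h (hno i), fun h => by
        linarith [(hF i).2.2.1 h], (hF i).2.2.2⟩
    simp only at this
    linarith
  have hXu : ∃ i, xs i ∈ R.Xu := by
    by_contra hno
    push Not at hno
    have := hle (z.1, z.2 + 1) fun i =>
      ⟨(hF i).1, (hF i).2.1, fun h => absurd h (hno i), (hF i).2.2.2⟩
    simp only at this
    linarith
  obtain ⟨i, hi⟩ := hX0
  obtain ⟨j, hj⟩ := hXu
  have h1 := (hF i).2.1 hi
  have h2 := (hF j).2.2.1 hj
  have h3 : (1 : ℝ) ≤ z.2 := hle (fun _ => 1, 1) fun i =>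
    ⟨zero_le_one, fun _ => le_rfl, fun _ => le_rfl, (hF i).2.2.2⟩
  refine Prod.ext (funext fun l => ?_) (by simp only; linarith)
  obtain rfl : l = 0 := Fin.fin_one_eq_zero l
  simp only
  linarith

end ConstantNetwork

/-! ### Testing a fixed decision -/

section FixedDecision

/-- The probability that `N` scenarios miss an event of probability greater than `ε`. -/
theorem measure_pi_compl_le {Ω : Type*} [MeasurableSpace Ω] (P : Measure Ω)
    [IsProbabilityMeasure P] {A : Set Ω} (hA : MeasurableSet A) {ε δ : ℝ} (hε : 0 < ε)
    (hε1 : ε < 1) (hδ : 0 < δ) {N : ℕ} (hN : Real.log (1 / δ) / ε ≤ N)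
    (hPA : ENNReal.ofReal ε < P A) :
    (Measure.pi fun _ : Fin N => P) {xs | ∀ i, xs i ∉ A} ≤ ENNReal.ofReal δ := by
  have hset : {xs : Fin N → Ω | ∀ i, xs i ∉ A} = Set.univ.pi fun _ => Aᶜ := by
    ext xs
    simp
  have hP : P Aᶜ ≤ ENNReal.ofReal (1 - ε) := by
    rw [prob_compl_eq_one_sub hA, ENNReal.ofReal_sub _ hε.le, ENNReal.ofReal_one]
    exact tsub_le_tsub_left hPA.le 1
  rw [hset, Measure.pi_pi, Finset.prod_const, Finset.card_univ, Fintype.card_fin]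
  refine (pow_le_pow_left' hP N).trans ?_
  rw [← ENNReal.ofReal_pow (by linarith)]
  refine ENNReal.ofReal_le_ofReal ((pow_le_pow_left₀ (by linarith)
    (Real.one_sub_le_exp_neg ε) N).trans ?_)
  rw [← Real.exp_nat_mul, ← Real.le_log_iff_exp_le hδ]
  rw [div_le_iff₀ hε, one_div, Real.log_inv] at hN
  linarith

end FixedDecision

/-! ### The linear program and its PAC guarantee -/

theorem theorem4 {n m k p : ℕ}
    (S : ControlSDE n m k) (π : Euc n → Euc k) (hπ : IsController S π)
    (R : ReachAvoidSets n)
    (φ : Euc n → Fin p → ℝ) (hφ : ∀ x ∈ R.X, ContDiffAt ℝ 2 φ x)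
    (εgen : ℝ) (hεgen : 0 < εgen) :
    -- for any samples in `X`, the scenario program is a linear program
    (∀ (N : ℕ) (xs : Fin N → Euc n), (∀ i, xs i ∈ R.X) →
      IsLinearProgram (E := LastLayer p × ℝ) scenarioObjective
        (scenarioFeasible S π R φ εgen xs)) ∧
    -- PAC guarantee
    (∀ (P : Measure (Euc n)) [IsProbabilityMeasure P], P (R.X)ᶜ = 0 →
      ∀ (ε δ : ℝ), 0 < ε → 0 < δ → δ < 1 →
      ∀ N : ℕ, 2 * (Real.log (1 / δ) + ((p + 1 : ℕ) : ℝ)) / ε ≤ (N : ℝ) →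
      -- a convex tie-break rule and the optimizer it selects (when there is an optimizer)
      ∀ (r : ℕ) (t : Fin r → LastLayer p × ℝ → ℝ), (∀ i, ConvexOn ℝ Set.univ (t i)) →
      ∀ zstar : (Fin N → Euc n) → LastLayer p × ℝ,
      AEMeasurable zstar (Measure.pi fun _ : Fin N => P) →
      (∀ᵐ xs ∂(Measure.pi fun _ : Fin N => P),
        (argminSet scenarioObjective (scenarioFeasible S π R φ εgen xs)).Nonempty →
        IsTieBreakChoice t (argminSet scenarioObjective (scenarioFeasible S π R φ εgen xs))
          (zstar xs)) →
      ENNReal.ofReal (1 - δ) ≤ (Measure.pi fun _ : Fin N => P)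
        {xs | (argminSet scenarioObjective (scenarioFeasible S π R φ εgen xs)).Nonempty →
          P {x | 0 < constraintFn S π R φ εgen (zstar xs).1 (zstar xs).2 x}
            ≤ ENNReal.ofReal ε}) := by
  refine ⟨fun N xs hxs => isLinearProgram_scenario fun i => hφ _ (hxs i), ?_⟩
  intro P _ hP ε δ hε hδ hδ1 N hN r t ht zstar _ hzstar
  have hG := isScenarioConstraint_domainConstraint (εgen := εgen) hπ hφ
  have hlog : 0 < Real.log (1 / δ) := Real.log_pos (by rwa [lt_div_iff₀ hδ, one_mul])
  have hX : ∀ᵐ xs ∂(Measure.pi fun _ : Fin N => P), ∀ i, xs i ∈ R.X :=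
    ae_all_iff.2 fun i => (measurePreserving_eval (fun _ : Fin N => P) i).quasiMeasurePreserving.ae
      (mem_ae_iff.2 hP)
  set good := {xs : Fin N → Euc n |
    (argminSet scenarioObjective (scenarioFeasible S π R φ εgen xs)).Nonempty →
      P {x | 0 < constraintFn S π R φ εgen (zstar xs).1 (zstar xs).2 x} ≤ ENNReal.ofReal ε}
  -- Subadditivity passes to the complement without requiring `good` to be measurable.
  suffices hbad : (Measure.pi fun _ : Fin N => P) goodᶜ ≤ ENNReal.ofReal δ by
    rw [ENNReal.ofReal_sub _ hδ.le, ENNReal.ofReal_one, tsub_le_iff_right]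
    calc (1 : ENNReal) = (Measure.pi fun _ : Fin N => P) (good ∪ goodᶜ) := by
          rw [Set.union_compl_self, measure_univ]
      _ ≤ _ := measure_union_le _ _
      _ ≤ _ := add_le_add_right hbad _
  rcases le_or_gt 1 ε with hε1 | hε1
  · have : goodᶜ = ∅ := Set.compl_empty_iff.2 (Set.eq_univ_of_forall fun xs _ =>
      prob_le_one.trans (ENNReal.one_le_ofReal.2 hε1))
    rw [this, measure_empty]
    exact zero_le
  have hbadmem : ∀ᵐ xs ∂(Measure.pi fun _ : Fin N => P), xs ∈ goodᶜ →
      (∀ i, xs i ∈ R.X) ∧ IsTieBreakChoice t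
        (argminSet scenarioObjective (scenarioFeasible S π R φ εgen xs)) (zstar xs) ∧
      ENNReal.ofReal ε < violation P (domainConstraint S π R φ εgen) (zstar xs) := by
    filter_upwards [hX, hzstar] with xs hxs hz hbad
    obtain ⟨hne, hviol⟩ := Classical.not_imp.1 hbad
    exact ⟨hxs, hz hne, (not_le.1 hviol).trans_le (measure_constraintFn_pos_le hP _)⟩
  rcases Nat.eq_zero_or_pos p with rfl | hp
  -- Either the only candidate `(1, 1)` is acceptable and bad samples form a null set, or every bad
  -- sample misses its violation event, of probability above `ε`.
  · rcases le_or_gt (violation P (domainConstraint S π R φ εgen) (fun _ => 1, 1))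
      (ENNReal.ofReal ε) with hviol | hviol
    · refine le_of_eq_of_le (measure_mono_null_ae (t := ∅) ?_ measure_empty) zero_le
      filter_upwards [hbadmem] with xs hxs hbad
      obtain ⟨hxX, hz, hlt⟩ := hxs hbad
      rw [eq_one_of_mem_argminSet_constant (fun i => hφ _ (hxX i)) hεgen hz.1] at hlt
      exact absurd hviol (not_le.2 hlt)
    · refine (measure_mono_ae ?_).trans (measure_pi_compl_le P
        (measurableSet_lt measurable_const (hG.measurable (fun _ => 1, 1))) hε hε1 hδ ?_ hviol)
      · filter_upwards [hbadmem] with xs hxs hbad i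
        obtain ⟨hxX, hz, -⟩ := hxs hbad
        have hfeas := hz.1.1
        rw [eq_one_of_mem_argminSet_constant (fun i => hφ _ (hxX i)) hεgen hz.1,
          scenarioFeasible_eq_feasibleSet hxX] at hfeas
        exact not_lt.2 (Set.mem_iInter.1 hfeas i)
      · refine le_trans (div_le_div_of_nonneg_right ?_ hε.le) hN
        push_cast
        linarith
  -- With `p ≥ 1` the dimension is at least `3`, and `d_v = p + 1` is the dimension minus one, as
  -- the tail bound requires.
  · have hdim : Module.finrank ℝ (LastLayer p × ℝ) = p + 2 := by
      rw [Module.finrank_prod, Module.finrank_self, Module.finrank_fin_fun]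
    refine (measure_mono_ae ?_).trans (measure_violation_gt_le_of_le P hG
      (isConvexKey_scenarioKeys ht) (by omega) hε hε1 hδ hδ1 (N := N) ?_)
    · filter_upwards [hbadmem] with xs hxs hbad
      obtain ⟨hxX, hz, hlt⟩ := hxs hbad
      refine ⟨zstar xs, ?_, hlt⟩
      rw [scenarioFeasible_eq_feasibleSet hxX] at hz
      exact keyMin_scenarioKeys_of_isTieBreakChoice hz
    · rw [hdim]
      refine le_of_eq_of_le ?_ hN
      push_cast
      ring
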